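/- **Setting.** Let $N$ be the number of particles, $d$ the dimension, $0\le\mathcal W\in L^1_{\mathrm{loc}}(\mathbb R^{dN})$, and let $\mathcal K_0=-\sum_{j=1}^N\kappa_j\Delta_j+\mathcal W$ be defined as a form sum on $L^2(\mathbb R^{dN})$; put $T=\mathcal K_0+1$. Let $\omega$ be a positive self-adjoint operator with trivial kernel on a separable complex Hilbert space $\mathfrak h$, and let $\mathfrak h_\omega$ be the completion of $\bigcap_k\mathcal D(\omega^k)$ for $\langle\cdot|\omega|\cdot\rangle$. For $z\in\mathfrak h_\omega$ let $\mathcal H_z$ be, as a quadratic form on the form domain of $\mathcal K_0$, one of the following. * (Nelson) $\mathcal H_z=\mathcal K_0+\sum_j 2\,\mathrm{Re}\langle z|\lambda(x_j)\rangle+\langle z|\omega|z\rangle$, with $\kappa_j=1$, $d\in\{1,2,3\}$ and $\lambda,\omega^{-1/2}\lambda\in L^\infty(\mathbb R^d;\mathfrak h)$. * (Fröhlich polaron) $\mathfrak h=L^2(\mathbb R^d)$, $d\in\{1,2,3\}$, $\omega=1$, $\kappa_j=1$ and $\mathcal H_z=\mathcal K_0+\sum_j\mathcal V_z(x_j)+\|z\|^2$,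 where $\mathcal V_z(x)=2\sqrt\alpha\,\mathrm{Re}\int \overline{z(k)}\,e^{-ik\cdot x}|k|^{-(d-1)/2}dk$ with $\alpha>0$. Here the part $|k|\le r$ (for a fixed $r>0$) is a bounded function, and the part $|k|>r$ is the divergence of a bounded vector field $c$, read as the form of the commutator $[\nabla,c]$. * (Pauli–Fierz) $d=3$, $\kappa_j=\frac1{2m_j}$ with $m_j>0$, and $\mathcal H_z=\sum_j\frac1{2m_j}\bigl(-i\nabla_j+e\,a_{z,j}(x_j)\bigr)^2+\mathcal W+\langle z|\omega|z\rangle$, where $e\in\mathbb R$, $a_{z,j,\ell}(x)=2\,\mathrm{Re}\langle z|\lambda_{j\ell}(x)\rangle$ and $\lambda_{j\ell},\omega^{-1/2}\lambda_{j\ell}\in L^\infty(\mathbb R^3;\mathfrak h)$. **Generalized states and measures.** A positive generalized state is a positive element of the weak-$*$ closure of the trace class operators in the dual of the bounded operators $\mathcal B(L^2(\mathbb R^{dN}))$. A generalized state is one of norm $1$, and it is pure if it is an extreme point of the set of generalized states. A generalized state-valued measure $\mathfrak n$ is a norm-countably additive measure on the Borel sets of $\mathfrak h_\omega$ with values in the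 positive generalized states; it is a probability measure if $\|\mathfrak n(\mathfrak h_\omega)\|=1$. Its norm measure is $m(S)=\|\mathfrak n(S)\|$, and $\int d\mathfrak n(z)[F(z)]$ is the continuous extension of $\sum_j\mathfrak n(S_j)[c_j]$ from simple functions to operator-valued functions $F$ that are Bochner integrable for $m$. A generalized state $\varrho$ (respectively, measure $\mathfrak n$) is in the domain of $T$ if there is a positive generalized state $\varrho_T$ (respectively, a generalized state-valued measure $\mathfrak n_T$, not necessarily normalized) with $\varrho_T[T^{-1/2}BT^{-1/2}]=\varrho[B]$ (respectively, $\mathfrak n_T(S)[T^{-1/2}BT^{-1/2}]=\mathfrak n(S)[B]$ for every Borel set $S$) for every bounded $B$. The energies are then $$\mathcal E_{\mathrm{gqc}}[\varrho,z]=\varrho_T\bigl[T^{-1/2}\mathcal H_zT^{-1/2}\bigr],\qquad \int d\mathfrak n(z)[\mathcal H_z]=\int d\mathfrak n_T(z)\bigl[T^{-1/2}\mathcal H_zT^{-1/2}\bigr],$$ the second one whenever the integrand is Bochner integrable for the norm measure of $\mathfrak n_T$. The first energy is to be minimized over the generalized states (or only over the pure ones) $\varrho$ in the domain of $T$ and over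 $z\in\mathfrak h_\omega$; the second over the generalized state-valued probability measures in the domain of $T$ with integrable integrand. **Proposition.** In each of the three models: 1. $\mathcal E_{\mathrm{gqc}}$ has a minimizer $(\varrho,z)$ with $\varrho$ a generalized state if and only if $\int d\mathfrak n(z)[\mathcal H_z]$ has a minimizer; and $\mathcal E_{\mathrm{gqc}}$ restricted to pure generalized states has a minimizer if and only if $\int d\mathfrak n(z)[\mathcal H_z]$ has one. 2. Every minimizing measure $\mathfrak n$ is concentrated on minimizers of $\mathcal E_{\mathrm{gqc}}$. That is, there are generalized states $\varrho_z$ with $\mathfrak n(S)[B]=\int_S\varrho_z[B]\,dm(z)$ for all Borel sets $S$ and all bounded $B$; and, for every such family and for $m$-almost every $z$, $(\varrho_z,z)$ is a minimizer of $\mathcal E_{\mathrm{gqc}}$ and $\varrho_z$ lies in the weak-$*$ closed convex hull of the pure generalized states $\sigma$ such that $(\sigma,z)$ minimizes $\mathcal E_{\mathrm{gqc}}$ among pure generalized states. -/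

import Mathlib

noncomputable section

open MeasureTheory Filter Topology
open scoped ComplexOrder InnerProductSpace ENNReal

namespace QuasiClassical

/-! ## Generalized states -/

section States

variable (H : Type*) [NormedAddCommGroup H] [InnerProductSpace ℂ H] [CompleteSpace H]

/-- Bounded operators on `H`. -/
abbrev BOp : Type _ := H →L[ℂ] H

/-- The functionals `B ↦ tr (Γ B)` with `Γ = ∑ₙ |yₙ⟩⟨xₙ|` trace class, inside the dual of the
bounded operators with its weak-* topology. -/
def traceClassFunctionals : Set (WeakDual ℂ (BOp H)) :=
  {F | ∃ x y : ℕ → H, Summable (fun n => ‖x n‖ ^ 2) ∧ Summable (fun n => ‖y n‖ ^ 2) ∧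
    ∀ B : BOp H, F B = ∑' n, inner ℂ (x n) (B (y n))}

/-- Positive elements of the weak-* closure of the trace class operators. -/
def genPositive : Set (StrongDual ℂ (BOp H)) :=
  {ρ | StrongDual.toWeakDual ρ ∈ closure (traceClassFunctionals H) ∧
    ∀ B : BOp H, 0 ≤ B → 0 ≤ ρ B}

/-- Normalized generalized states. -/
def genStates : Set (StrongDual ℂ (BOp H)) := {ρ | ρ ∈ genPositive H ∧ ‖ρ‖ = 1}

/-- Pure generalized states: the extreme points of the set of normalized generalized states. -/
def genPureStates : Set (StrongDual ℂ (BOp H)) := (genStates H).extremePoints ℝ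

variable {H}

/-- The norm of a positive functional is its value at the identity. -/
theorem norm_eq_of_positive {ρ : StrongDual ℂ (BOp H)} (h : ∀ B : BOp H, 0 ≤ B → 0 ≤ ρ B) :
    ((‖ρ‖ : ℝ) : ℂ) = ρ 1 := by
  have h1 : 0 ≤ ρ 1 := h 1 zero_le_one
  have him : (ρ 1).im = 0 := ((Complex.nonneg_iff.mp h1).2).symm
  have hre : 0 ≤ (ρ 1).re := (Complex.nonneg_iff.mp h1).1
  have hsa : ∀ A : BOp H, IsSelfAdjoint A → (ρ A).im = 0 ∧ (ρ A).re ≤ ‖A‖ * (ρ 1).re := by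
    intro A hA
    have h2 : 0 ≤ ρ (algebraMap ℝ (BOp H) ‖A‖ - A) :=
      h _ (sub_nonneg.mpr hA.le_algebraMap_norm_self)
    have h3 : ρ (algebraMap ℝ (BOp H) ‖A‖ - A) = (‖A‖ : ℂ) * ρ 1 - ρ A := by
      rw [map_sub, Algebra.algebraMap_eq_smul_one, ← Complex.coe_smul, map_smul, smul_eq_mul]
    rw [h3, Complex.nonneg_iff] at h2
    obtain ⟨h4, h5⟩ := h2
    simp [him] at h4 h5
    exact ⟨h5, h4⟩
  have key : ‖ρ‖ = (ρ 1).re := by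
    apply le_antisymm
    · refine ContinuousLinearMap.opNorm_le_bound _ hre fun B => ?_
      obtain ⟨c, hc, hcB⟩ : ∃ c : ℂ, ‖c‖ = 1 ∧ c * ρ B = (‖ρ B‖ : ℂ) := by
        by_cases hB : ρ B = 0
        · exact ⟨1, by simp, by simp [hB]⟩
        · refine ⟨(‖ρ B‖ : ℂ) / ρ B, ?_, div_mul_cancel₀ _ hB⟩
          simp [hB]
      have h6 := hsa _ (realPart (c • B)).2
      have h7 := hsa _ (imaginaryPart (c • B)).2
      have h8 : ρ (c • B) = ρ (realPart (c • B) : BOp H)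
          + Complex.I * ρ (imaginaryPart (c • B) : BOp H) := by
        conv_lhs => rw [← realPart_add_I_smul_imaginaryPart (c • B)]
        rw [map_add, ρ.map_smul Complex.I, smul_eq_mul]
      rw [map_smul, smul_eq_mul, hcB] at h8
      have h9 := congrArg Complex.re h8
      simp only [Complex.ofReal_re, Complex.add_re, Complex.mul_re, Complex.I_re, zero_mul,
        Complex.I_im, one_mul, h7.1, sub_zero, add_zero] at h9
      rw [h9, mul_comm]
      refine h6.2.trans (mul_le_mul_of_nonneg_right ?_ hre)
      refine (realPart.norm_le (c • B)).trans ?_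
      rw [norm_smul, hc, one_mul]
    · have h10 : ‖ρ 1‖ ≤ ‖ρ‖ * ‖(1 : BOp H)‖ := ρ.le_opNorm 1
      have h11 : (ρ 1).re ≤ ‖ρ 1‖ := Complex.re_le_norm _
      have h12 : ‖(1 : BOp H)‖ ≤ 1 := ContinuousLinearMap.norm_id_le
      nlinarith [norm_nonneg ρ]
  rw [key]
  exact Complex.ext (by simp) (by simp [him])

end States

/-! ## Generalized state-valued measures and integration -/

section Measures

variable (X : Type*) [MeasurableSpace X] (H : Type*) [NormedAddCommGroup H]
  [InnerProductSpace ℂ H] [CompleteSpace H]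

/-- A generalized state-valued measure: a countably additive measure (unconditionally in the norm
of the dual of the bounded operators) with values in the positive generalized states. -/
structure GenMeasure where
  /-- the underlying vector measure -/
  vm : VectorMeasure X (StrongDual ℂ (BOp H))
  mem_genPositive : ∀ S, MeasurableSet S → vm S ∈ genPositive H

variable {X H}

namespace GenMeasure

theorem norm_apply_eq (n : GenMeasure X H) {S : Set X} (hS : MeasurableSet S) :
    ‖n.vm S‖ = (n.vm S 1).re := by
  rw [← norm_eq_of_positive (n.mem_genPositive S hS).2, Complex.ofReal_re]

/-- The scalar norm measure `S ↦ ‖n S‖`. -/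
def normMeasure (n : GenMeasure X H) : Measure X :=
  Measure.ofMeasurable (fun S _ => ENNReal.ofReal ‖n.vm S‖) (by simp) (by
    intro f hf hd
    have h1 := (n.vm.m_iUnion hf hd)
    have h2 : HasSum (fun i => (n.vm (f i) 1).re) (n.vm (⋃ i, f i) 1).re := by
      have h3 := h1.mapL (ContinuousLinearMap.apply ℂ ℂ (1 : BOp H))
      exact Complex.reCLM.hasSum h3
    have h4 : ∀ i, 0 ≤ (n.vm (f i) 1).re := fun i => by
      rw [← n.norm_apply_eq (hf i)]; exact norm_nonneg _
    simp only [n.norm_apply_eq (MeasurableSet.iUnion hf), n.norm_apply_eq (hf _)]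
    rw [← h2.tsum_eq, ENNReal.ofReal_tsum_of_nonneg h4 h2.summable])

theorem normMeasure_apply (n : GenMeasure X H) {S : Set X} (hS : MeasurableSet S) :
    n.normMeasure S = ENNReal.ofReal ‖n.vm S‖ :=
  Measure.ofMeasurable_apply S hS

/-- The set function `S ↦ (B ↦ n(S)[B])`, over the reals. -/
def setFun (n : GenMeasure X H) (S : Set X) : BOp H →L[ℝ] ℂ := (n.vm S).restrictScalars ℝ

theorem dominated (n : GenMeasure X H) :
    DominatedFinMeasAdditive n.normMeasure n.setFun 1 := by
  refine ⟨fun s t hs ht _ _ hd => ?_, fun s hs _ => ?_⟩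
  · ext B
    simp [setFun, n.vm.of_union hd hs ht]
  · rw [one_mul, Measure.real, n.normMeasure_apply hs, ENNReal.toReal_ofReal (norm_nonneg _)]
    exact le_of_eq (ContinuousLinearMap.norm_restrictScalars _)

/-- The integral `∫ dn(z)[F(z)]` of an operator-valued function: the continuous extension of
`∑ⱼ n(Sⱼ)[cⱼ]` from simple functions to functions that are absolutely integrable, i.e. Bochner
integrable for the norm measure. -/
def integral (n : GenMeasure X H) (F : X → BOp H) : ℂ :=
  setToFun n.normMeasure n.setFun n.dominated F

end GenMeasure

end Measures

/-! ## The generalized variational problems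

`Q` is the form domain of `T = 𝒦₀ + 1`, a Hilbert space for the form of `T`, and `J : Q → H` is
the inclusion.  The form of `ℋ_z` is given on `Q` for every classical configuration `z : X`. -/

section Variational

variable {H : Type*} [NormedAddCommGroup H] [InnerProductSpace ℂ H] [CompleteSpace H]
  {Q : Type*} [NormedAddCommGroup Q] [InnerProductSpace ℂ Q] [CompleteSpace Q]
  {X : Type*} [MeasurableSpace X]

/-- `T⁻¹ = J J†`: the vector `u = J† f` is the solution in `Q` of `⟪v, u⟫_Q = ⟪J v, f⟫` for all
`v : Q`, where `⟪·, ·⟫_Q` is the closed form of `T`. -/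
def invT (J : Q →L[ℂ] H) : BOp H := J ∘L ContinuousLinearMap.adjoint J

/-- `T^{-1/2}`. -/
def invSqrtT (J : Q →L[ℂ] H) : BOp H := CFC.sqrt (invT J)

/-- `A = T^{-1/2} 𝓕 T^{-1/2}` for the operator `𝓕` with form `a` on `Q`:
`⟪f, A g⟫ = a(T^{-1/2} f, T^{-1/2} g)` for all `f, g`. -/
def IsSandwich (J : Q →L[ℂ] H) (a : Q → Q → ℂ) (A : BOp H) : Prop :=
  ∀ (f g : H) (u v : Q), J u = invSqrtT J f → J v = invSqrtT J g → inner ℂ f (A g) = a u v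

/-- `e` is the value `ρ[ℋ_z] = ρ_T[T^{-1/2} ℋ_z T^{-1/2}]`, where `ρ_T` is a positive generalized
state with `ρ_T[T^{-1/2} B T^{-1/2}] = ρ[B]`; in particular `ρ` is in the domain of `T`. -/
def IsGqcEnergy (J : Q →L[ℂ] H) (a : X → Q → Q → ℂ) (ρ : StrongDual ℂ (BOp H)) (z : X)
    (e : ℝ) : Prop :=
  ∃ ρT ∈ genPositive H, (∀ B : BOp H, ρT (invSqrtT J * B * invSqrtT J) = ρ B) ∧
    ∃ A : BOp H, IsSandwich J (a z) A ∧ ρT A = (e : ℂ)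

/-- The infimum of the energy `ρ[ℋ_z]` over `z` and over the states `ρ` in the class `𝒮`. -/
def gqcInf (J : Q →L[ℂ] H) (a : X → Q → Q → ℂ) (𝒮 : Set (StrongDual ℂ (BOp H))) : EReal :=
  sInf {E : EReal | ∃ ρ ∈ 𝒮, ∃ (z : X) (e : ℝ), IsGqcEnergy J a ρ z e ∧ E = (e : EReal)}

/-- `(ρ, z)` minimizes the energy `ρ[ℋ_z]` over the states `ρ` in the class `𝒮` and over `z`. -/
def IsGqcMinimizer (J : Q →L[ℂ] H) (a : X → Q → Q → ℂ) (𝒮 : Set (StrongDual ℂ (BOp H)))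
    (ρ : StrongDual ℂ (BOp H)) (z : X) : Prop :=
  ρ ∈ 𝒮 ∧ ∃ e : ℝ, IsGqcEnergy J a ρ z e ∧ (e : EReal) = gqcInf J a 𝒮

/-- `nT` exhibits `n` as a measure in the domain of `T`. -/
def IsLift (J : Q →L[ℂ] H) (n nT : GenMeasure X H) : Prop :=
  ∀ S, MeasurableSet S → ∀ B : BOp H, nT.vm S (invSqrtT J * B * invSqrtT J) = n.vm S B

/-- `e` is the value `∫ dn(z)[ℋ_z] = ∫ dn_T(z)[T^{-1/2} ℋ_z T^{-1/2}]`; in particular `n` is in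
the domain of `T` and the integrand is absolutely integrable. -/
def IsGsvmEnergy (J : Q →L[ℂ] H) (a : X → Q → Q → ℂ) (n : GenMeasure X H) (e : ℝ) : Prop :=
  ∃ nT : GenMeasure X H, IsLift J n nT ∧
    ∃ A : X → BOp H, (∀ z, IsSandwich J (a z) (A z)) ∧ Integrable A nT.normMeasure ∧
      nT.integral A = (e : ℂ)

/-- The infimum of `∫ dn(z)[ℋ_z]` over the generalized state-valued probability measures. -/
def gsvmInf (J : Q →L[ℂ] H) (a : X → Q → Q → ℂ) : EReal :=
  sInf {E : EReal | ∃ n : GenMeasure X H, ‖n.vm Set.univ‖ = 1 ∧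
    ∃ e : ℝ, IsGsvmEnergy J a n e ∧ E = (e : EReal)}

/-- `n` minimizes `∫ dn(z)[ℋ_z]` over the generalized state-valued probability measures. -/
def IsGsvmMinimizer (J : Q →L[ℂ] H) (a : X → Q → Q → ℂ) (n : GenMeasure X H) : Prop :=
  ‖n.vm Set.univ‖ = 1 ∧ ∃ e : ℝ, IsGsvmEnergy J a n e ∧ (e : EReal) = gsvmInf J a

/-- `dn(z) = ρ_z dm(z)` in the weak-* sense, where `m` is the norm measure of `n` and the `ρ_z`
are normalized generalized states. -/
def IsWeakDensity (n : GenMeasure X H) (ρ : X → StrongDual ℂ (BOp H)) : Prop :=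
  (∀ᵐ z ∂n.normMeasure, ρ z ∈ genStates H) ∧
    ∀ B : BOp H, Integrable (fun z => ρ z B) n.normMeasure ∧
      ∀ S, MeasurableSet S → n.vm S B = ∫ z in S, ρ z B ∂n.normMeasure

/-- `n` is concentrated on the minimizers of the energy `ρ[ℋ_z]`: it has a weak-* density
`dn(z) = ρ_z dm(z)`, and for every such density and almost every `z`, the pair `(ρ_z, z)` is a
minimizer and `ρ_z` is a (possibly infinite) convex combination of pure states `σ` such that
`(σ, z)` is a minimizer among the pure states, i.e. belongs to their weak-* closed convex hull. -/
def IsConcentrated (J : Q →L[ℂ] H) (a : X → Q → Q → ℂ) (n : GenMeasure X H) : Prop :=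
  (∃ ρ, IsWeakDensity n ρ) ∧
    ∀ ρ, IsWeakDensity n ρ → ∀ᵐ z ∂n.normMeasure,
      IsGqcMinimizer J a (genStates H) (ρ z) z ∧
      StrongDual.toWeakDual (ρ z) ∈
        closure (convexHull ℝ (StrongDual.toWeakDual ''
          {σ : StrongDual ℂ (BOp H) | IsGqcMinimizer J a (genPureStates H) σ z}))

/-- The energy `ρ[ℋ_z]` has a minimizer (among all, equivalently among pure generalized states) if
and only if `∫ dn(z)[ℋ_z]` has one, and every minimizing measure is concentrated on minimizers. -/
def MinimizerEquivalence (J : Q →L[ℂ] H) (a : X → Q → Q → ℂ) : Prop :=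
  ((∃ ρ z, IsGqcMinimizer J a (genStates H) ρ z) ↔
      ∃ n : GenMeasure X H, IsGsvmMinimizer J a n) ∧
  ((∃ ρ z, IsGqcMinimizer J a (genPureStates H) ρ z) ↔
      ∃ n : GenMeasure X H, IsGsvmMinimizer J a n) ∧
  ∀ n : GenMeasure X H, IsGsvmMinimizer J a n → IsConcentrated J a n

end Variational

/-! ## The particles: `𝒦₀ = -∑ⱼ κⱼ Δⱼ + 𝒲` on `L²(ℝ^{dN})` -/

section Particles

/-- The configuration space `ℝ^{dN}`. -/
abbrev Cfg (N d : ℕ) : Type := EuclideanSpace ℝ (Fin N × Fin d)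

/-- The position `x_j` of the `j`-th particle. -/
def pos {N d : ℕ} (x : Cfg N d) (j : Fin N) : EuclideanSpace ℝ (Fin d) :=
  WithLp.toLp 2 fun i => x (j, i)

/-- `L²(ℝ^{dN})`. -/
abbrev L2 (N d : ℕ) : Type := Lp ℂ 2 (volume : Measure (Cfg N d))

/-- `g` is the weak partial derivative of `f` in the direction of the coordinate `p`. -/
def IsWeakDeriv {N d : ℕ} (p : Fin N × Fin d) (f g : L2 N d) : Prop :=
  ∀ φ : Cfg N d → ℝ, ContDiff ℝ ((⊤ : ℕ∞) : WithTop ℕ∞) φ → HasCompactSupport φ →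
    ∫ x, ((fderiv ℝ φ x (EuclideanSpace.single p 1) : ℝ) : ℂ) * f x = -∫ x, (φ x : ℂ) * g x

theorem exists_pairing {N d : ℕ} {φ : Cfg N d → ℝ} (hφ : Continuous φ)
    (hc : HasCompactSupport φ) :
    ∃ ℓ : L2 N d →L[ℂ] ℂ, ∀ f, ∫ x, (φ x : ℂ) * f x = ℓ f := by
  have h1 : Continuous fun x => (φ x : ℂ) := Complex.continuous_ofReal.comp hφ
  have h2 : HasCompactSupport fun x => (φ x : ℂ) := hc.comp_left (g := fun t : ℝ => (t : ℂ)) rfl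
  have h3 : MemLp (fun x => (φ x : ℂ)) 2 (volume : Measure (Cfg N d)) :=
    h1.memLp_of_hasCompactSupport h2
  refine ⟨innerSL ℂ (h3.toLp _), fun f => ?_⟩
  rw [innerSL_apply_apply, L2.inner_def]
  refine integral_congr_ae ?_
  filter_upwards [h3.coeFn_toLp] with x hx
  rw [hx, RCLike.inner_apply]
  simp [mul_comm]

theorem isWeakDeriv_iff {N d : ℕ} (p : Fin N × Fin d) :
    ∃ 𝓛 : Set ((L2 N d →L[ℂ] ℂ) × (L2 N d →L[ℂ] ℂ)), ∀ f g : L2 N d,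
      IsWeakDeriv p f g ↔ ∀ ℓ ∈ 𝓛, ℓ.1 f = -ℓ.2 g := by
  refine ⟨{ℓ | ∃ φ : Cfg N d → ℝ, ContDiff ℝ ((⊤ : ℕ∞) : WithTop ℕ∞) φ ∧ HasCompactSupport φ ∧
    (∀ f : L2 N d, ∫ x, ((fderiv ℝ φ x (EuclideanSpace.single p 1) : ℝ) : ℂ) * f x = ℓ.1 f) ∧
    ∀ g : L2 N d, ∫ x, (φ x : ℂ) * g x = ℓ.2 g}, fun f g => ⟨?_, ?_⟩⟩
  · rintro h ⟨ℓ₁, ℓ₂⟩ ⟨φ, h1, h2, h3, h4⟩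
    rw [← h3, ← h4]
    exact h φ h1 h2
  · intro h φ h1 h2
    obtain ⟨ℓ₁, h3⟩ := exists_pairing (N := N) (d := d)
      (φ := fun x => fderiv ℝ φ x (EuclideanSpace.single p 1))
      ((h1.continuous_fderiv (by simp)).clm_apply continuous_const) (h2.fderiv_apply ℝ _)
    obtain ⟨ℓ₂, h4⟩ := exists_pairing h1.continuous h2
    rw [h3, h4]
    exact h (ℓ₁, ℓ₂) ⟨φ, h1, h2, h3, h4⟩

/-- Pairs `(f, g)` with `g = √W f` almost everywhere. -/
def IsSqrtMul {N d : ℕ} (W : Cfg N d → ℝ) (f g : L2 N d) : Prop :=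
  ∀ᵐ x, g x = (√(W x) : ℂ) * f x

/-- Index set for the components of an element of the form domain. -/
inductive Comp (N d : ℕ) : Type
  /-- `ψ` -/
  | state : Comp N d
  /-- `√𝒲 ψ` -/
  | pot : Comp N d
  /-- `√κⱼ ∂_{j,i} ψ` -/
  | grad : Fin N × Fin d → Comp N d
  deriving DecidableEq, Fintype

/-- The form domain of `T = 𝒦₀ + 1`, as the subspace of all `(ψ, √𝒲 ψ, (√κⱼ ∂_{j,i} ψ))` in a
Hilbert sum of copies of `L²`; its inner product is the form of `T`. -/
def formSubmodule {N d : ℕ} (κ : Fin N → ℝ) (W : Cfg N d → ℝ) :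
    Submodule ℂ (PiLp 2 fun _ : Comp N d => L2 N d) where
  carrier := {u | IsSqrtMul W (u .state) (u .pot) ∧
    ∀ p, IsWeakDeriv p (((√(κ p.1) : ℝ) : ℂ) • u .state) (u (.grad p))}
  add_mem' := by
    rintro u v ⟨hu, hu'⟩ ⟨hv, hv'⟩
    refine ⟨?_, fun p => ?_⟩
    · filter_upwards [hu, hv, Lp.coeFn_add (u .state) (v .state), Lp.coeFn_add (u .pot) (v .pot)]
        with x h1 h2 h3 h4
      simp only [PiLp.add_apply]
      rw [h3, h4, Pi.add_apply, Pi.add_apply, h1, h2, mul_add]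
    · obtain ⟨𝓛, h𝓛⟩ := isWeakDeriv_iff (N := N) (d := d) p
      rw [h𝓛]
      intro ℓ hℓ
      have h1 := (h𝓛 _ _).mp (hu' p) ℓ hℓ
      have h2 := (h𝓛 _ _).mp (hv' p) ℓ hℓ
      simp only [PiLp.add_apply, smul_add, map_add, h1, h2]
      ring
  zero_mem' := by
    refine ⟨?_, fun p => ?_⟩
    · filter_upwards [Lp.coeFn_zero ℂ 2 (volume : Measure (Cfg N d))] with x h1
      simp only [PiLp.zero_apply]
      rw [h1]; simp
    · obtain ⟨𝓛, h𝓛⟩ := isWeakDeriv_iff (N := N) (d := d) p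
      rw [h𝓛]
      intro ℓ hℓ
      simp
  smul_mem' := by
    rintro c u ⟨hu, hu'⟩
    refine ⟨?_, fun p => ?_⟩
    · filter_upwards [hu, Lp.coeFn_smul c (u .state), Lp.coeFn_smul c (u .pot)] with x h1 h3 h4
      simp only [PiLp.smul_apply]
      rw [h3, h4, Pi.smul_apply, Pi.smul_apply, h1, smul_eq_mul, smul_eq_mul]
      ring
    · obtain ⟨𝓛, h𝓛⟩ := isWeakDeriv_iff (N := N) (d := d) p
      rw [h𝓛]
      intro ℓ hℓ
      have h1 := (h𝓛 _ _).mp (hu' p) ℓ hℓ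
      simp only [PiLp.smul_apply]
      rw [smul_comm, map_smul, h1, map_smul, smul_neg]

theorem isClosed_formSubmodule {N d : ℕ} (κ : Fin N → ℝ) (W : Cfg N d → ℝ) :
    IsClosed (formSubmodule κ W : Set (PiLp 2 fun _ : Comp N d => L2 N d)) := by
  have hcont : ∀ i : Comp N d, Continuous fun u : PiLp 2 (fun _ : Comp N d => L2 N d) => u i :=
    fun i => PiLp.continuous_apply 2 _ i
  have h1 : IsClosed {u : PiLp 2 (fun _ : Comp N d => L2 N d) |
      IsSqrtMul W (u .state) (u .pot)} := by
    refine IsSeqClosed.isClosed fun u u₀ hu hlim => ?_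
    have hs := ((hcont .state).tendsto u₀).comp hlim
    have hp := ((hcont .pot).tendsto u₀).comp hlim
    obtain ⟨ns, hns, hs'⟩ := (tendstoInMeasure_of_tendsto_Lp hs).exists_seq_tendsto_ae
    have hp' := hp.comp hns.tendsto_atTop
    obtain ⟨ms, hms, hp''⟩ := (tendstoInMeasure_of_tendsto_Lp hp').exists_seq_tendsto_ae
    have hall : ∀ᵐ x, ∀ k, u k .pot x = (√(W x) : ℂ) * u k .state x := ae_all_iff.mpr hu
    filter_upwards [hs', hp'', hall] with x ha hb hc
    refine tendsto_nhds_unique hb ?_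
    have := (ha.comp hms.tendsto_atTop).const_mul (√(W x) : ℂ)
    refine this.congr fun k => ?_
    simp only [Function.comp_apply]
    rw [hc]
  have h2 : ∀ p, IsClosed {u : PiLp 2 (fun _ : Comp N d => L2 N d) |
      IsWeakDeriv p (((√(κ p.1) : ℝ) : ℂ) • u .state) (u (.grad p))} := by
    intro p
    obtain ⟨𝓛, h𝓛⟩ := isWeakDeriv_iff (N := N) (d := d) p
    simp only [h𝓛, Set.ofPred_forall]
    refine isClosed_iInter fun ℓ => isClosed_iInter fun _ => isClosed_eq ?_ ?_
    · have h4 : Continuous fun u : PiLp 2 (fun _ : Comp N d => L2 N d) =>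
          ((√(κ p.1) : ℝ) : ℂ) • u .state := (hcont .state).fun_const_smul _
      exact ℓ.1.continuous.comp h4
    · exact (ℓ.2.continuous.comp (hcont (.grad p))).neg
  have h3 : (formSubmodule κ W : Set (PiLp 2 fun _ : Comp N d => L2 N d)) =
      {u | IsSqrtMul W (u .state) (u .pot)} ∩
        ⋂ p, {u | IsWeakDeriv p (((√(κ p.1) : ℝ) : ℂ) • u .state) (u (.grad p))} := by
    ext u
    simp [formSubmodule]
  rw [h3]
  exact h1.inter (isClosed_iInter h2)

/-- The form domain of `T = 𝒦₀ + 1` with the form of `T` as inner product. -/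
abbrev FormDomain {N d : ℕ} (κ : Fin N → ℝ) (W : Cfg N d → ℝ) : Type := ↥(formSubmodule κ W)

instance {N d : ℕ} (κ : Fin N → ℝ) (W : Cfg N d → ℝ) : CompleteSpace (FormDomain κ W) :=
  (isClosed_formSubmodule κ W).completeSpace_coe

/-- The inclusion of the form domain into `L²`. -/
def incl {N d : ℕ} (κ : Fin N → ℝ) (W : Cfg N d → ℝ) : FormDomain κ W →L[ℂ] L2 N d :=
  (PiLp.proj 2 (fun _ : Comp N d => L2 N d) .state) ∘L (formSubmodule κ W).subtypeL

variable {N d : ℕ} {κ : Fin N → ℝ} {W : Cfg N d → ℝ}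

/-- The form of `𝒦₀ = -∑ⱼ κⱼ Δⱼ + 𝒲`. -/
def freeForm (u v : FormDomain κ W) : ℂ :=
  inner ℂ (u.1 .pot) (v.1 .pot) + ∑ p, inner ℂ (u.1 (.grad p)) (v.1 (.grad p))

/-- `⟨f| b |g⟩` for the multiplication operator by `b`. -/
def mulForm (b : Cfg N d → ℂ) (f g : L2 N d) : ℂ :=
  ∫ x, starRingEnd ℂ (f x) * b x * g x

end Particles

/-! ## The classical field -/

section Field

/-- A one-excitation energy: a positive self-adjoint operator with trivial kernel. -/
structure Dispersion (𝔥 : Type*) [NormedAddCommGroup 𝔥] [InnerProductSpace ℂ 𝔥]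
    [CompleteSpace 𝔥] where
  /-- the operator `ω` -/
  op : 𝔥 →ₗ.[ℂ] 𝔥
  selfAdjoint : IsSelfAdjoint op
  nonneg : ∀ x : op.domain, 0 ≤ inner ℂ (x : 𝔥) (op x)
  injective : Function.Injective op

variable {𝔥 : Type*} [NormedAddCommGroup 𝔥] [InnerProductSpace ℂ 𝔥] [CompleteSpace 𝔥]

namespace Dispersion

variable (ω : Dispersion 𝔥)

/-- The domain of `ω ^ k`. -/
def powDomain : ℕ → Submodule ℂ 𝔥
  | 0 => ⊤
  | k + 1 => ((powDomain k).comap ω.op.toFun).map ω.op.domain.subtype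

theorem mem_domain_of_mem {x : 𝔥} (hx : x ∈ ⨅ k, ω.powDomain k) : x ∈ ω.op.domain := by
  have h := (Submodule.mem_iInf _).mp hx 1
  obtain ⟨y, -, rfl⟩ := h
  exact y.2

/-- `⋂ₖ 𝒟(ωᵏ)`, to be normed by the form of `ω`. -/
def SmoothVec : Type _ := ↥(⨅ k, ω.powDomain k)

instance : AddCommGroup ω.SmoothVec := inferInstanceAs (AddCommGroup ↥(⨅ k, ω.powDomain k))

instance : Module ℂ ω.SmoothVec := inferInstanceAs (Module ℂ ↥(⨅ k, ω.powDomain k))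

/-- The inclusion of `⋂ₖ 𝒟(ωᵏ)` in the domain of `ω`. -/
def toDomain : ω.SmoothVec →ₗ[ℂ] ω.op.domain :=
  Submodule.inclusion fun _ hx => ω.mem_domain_of_mem hx

/-- The inner product `⟨x|ω|y⟩` on `⋂ₖ 𝒟(ωᵏ)`. -/
@[reducible] def formCore : PreInnerProductSpace.Core ℂ ω.SmoothVec where
  inner x y := inner ℂ (ω.toDomain x : 𝔥) (ω.op (ω.toDomain y))
  conj_inner_symm x y := by
    have h : ω.op.IsFormalAdjoint ω.op := by
      have h1 := LinearPMap.adjoint_isFormalAdjoint ω.selfAdjoint.dense_domain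
      rwa [LinearPMap.isSelfAdjoint_def.mp ω.selfAdjoint] at h1
    rw [inner_conj_symm]
    exact h _ _
  re_inner_nonneg x := (Complex.nonneg_iff.mp (ω.nonneg _)).1
  add_left x y z := by simp
  smul_left x y r := by simp [mul_comm]

instance : SeminormedAddCommGroup ω.SmoothVec :=
  @InnerProductSpace.Core.toSeminormedAddCommGroup ℂ _ _ _ _ (formCore ω)

instance : InnerProductSpace ℂ ω.SmoothVec := InnerProductSpace.ofCore (formCore ω)

/-- The space `𝔥_ω` of classical field configurations: the Hilbert completion of `⋂ₖ 𝒟(ωᵏ)` for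
the inner product `⟨·|ω|·⟩`. -/
abbrev FieldSpace : Type _ := UniformSpace.Completion ω.SmoothVec

instance : MeasurableSpace ω.FieldSpace := borel _

instance : BorelSpace ω.FieldSpace := ⟨rfl⟩

/-- `v ∈ 𝒟(ω^{-1/2})` with `‖ω^{-1/2} v‖ ≤ C`: the functional `y ↦ ⟨v|y⟩` is bounded by `C` for
the norm of `𝔥_ω`. -/
def InvSqrtBound (v : 𝔥) (C : ℝ) : Prop :=
  ∀ y : ω.SmoothVec, ‖inner ℂ v (ω.toDomain y : 𝔥)‖ ≤ C * ‖y‖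

/-- `⟨v|z⟩ = ⟨ω^{-1/2} v|ω^{1/2} z⟩` for `v ∈ 𝒟(ω^{-1/2})` and `z ∈ 𝔥_ω`: the continuous extension
of `y ↦ ⟨v|y⟩` from `⋂ₖ 𝒟(ωᵏ)`. -/
def pairing (v : 𝔥) (z : ω.FieldSpace) : ℂ :=
  UniformSpace.Completion.extension (fun y : ω.SmoothVec => inner ℂ v (ω.toDomain y : 𝔥)) z

/-- `λ, ω^{-1/2} λ ∈ L^∞(ℝᵈ; 𝔥)`. -/
def IsFormFactor {d : ℕ} (lam : EuclideanSpace ℝ (Fin d) → 𝔥) : Prop :=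
  MemLp lam ⊤ volume ∧ ∃ C : ℝ, ∀ᵐ x, ω.InvSqrtBound (lam x) C

/-- The classical field `2 Re ⟨z|λ(x)⟩`. -/
def classicalField {d : ℕ} (lam : EuclideanSpace ℝ (Fin d) → 𝔥) (z : ω.FieldSpace)
    (x : EuclideanSpace ℝ (Fin d)) : ℝ :=
  2 * (ω.pairing (lam x) z).re

end Dispersion

end Field

/-! ## The three models -/

section Models

variable {N d : ℕ} {κ : Fin N → ℝ} {W : Cfg N d → ℝ}
  {𝔥 : Type*} [NormedAddCommGroup 𝔥] [InnerProductSpace ℂ 𝔥] [CompleteSpace 𝔥]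

/-- Nelson model: the form of `ℋ_z = 𝒦₀ + ∑ⱼ 2 Re ⟨z|λ(xⱼ)⟩ + ⟨z|ω|z⟩`. -/
def nelsonForm (ω : Dispersion 𝔥) (lam : EuclideanSpace ℝ (Fin d) → 𝔥) (z : ω.FieldSpace)
    (u v : FormDomain κ W) : ℂ :=
  freeForm u v
    + ∑ j, mulForm (fun x => (ω.classicalField lam z (pos x j) : ℂ)) (u.1 .state) (v.1 .state)
    + ((‖z‖ ^ 2 : ℝ) : ℂ) * inner ℂ (u.1 .state) (v.1 .state)

/-- The field space `𝔥_ω = L²(ℝᵈ)` of the polaron, where `ω = 1`. -/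
abbrev PolaronSpace (d : ℕ) : Type := Lp ℂ 2 (volume : Measure (EuclideanSpace ℝ (Fin d)))

instance (d : ℕ) : MeasurableSpace (PolaronSpace d) := borel _

instance (d : ℕ) : BorelSpace (PolaronSpace d) := ⟨rfl⟩

/-- `∫ \overline{z(k)} e^{-i k·x} χ(k) dk`. -/
def polaronPairing (χ : EuclideanSpace ℝ (Fin d) → ℝ) (z : PolaronSpace d)
    (x : EuclideanSpace ℝ (Fin d)) : ℂ :=
  ∫ k, starRingEnd ℂ (z k) * Complex.exp (-(Complex.I * ((inner ℝ k x : ℝ) : ℂ))) * (χ k : ℂ)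

/-- Low-frequency part of the form factor: `1_{|k| ≤ r} |k|^{-(d-1)/2}`. -/
def polaronLow (r : ℝ) (k : EuclideanSpace ℝ (Fin d)) : ℝ :=
  if ‖k‖ ≤ r then ‖k‖ ^ (-((d : ℝ) - 1) / 2) else 0

/-- High-frequency part: the `i`-th component of `1_{|k| > r} |k|^{-(d+1)/2} k / |k|`. -/
def polaronHigh (r : ℝ) (i : Fin d) (k : EuclideanSpace ℝ (Fin d)) : ℝ :=
  if r < ‖k‖ then ‖k‖ ^ (-((d : ℝ) + 1) / 2) * (k i / ‖k‖) else 0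

/-- The bounded function `2 Re ∫_{|k| ≤ r} \overline{z(k)} e^{-i k·x} |k|^{-(d-1)/2} dk`. -/
def polaronLowField (r : ℝ) (z : PolaronSpace d) (x : EuclideanSpace ℝ (Fin d)) : ℝ :=
  2 * (polaronPairing (polaronLow r) z x).re

/-- The bounded vector field whose divergence is the high-frequency part
`2 Re ∫_{|k| > r} \overline{z(k)} e^{-i k·x} |k|^{-(d-1)/2} dk` of the potential. -/
def polaronHighField (r : ℝ) (z : PolaronSpace d) (i : Fin d)
    (x : EuclideanSpace ℝ (Fin d)) : ℝ :=
  2 * (Complex.I * polaronPairing (polaronHigh r i) z x).re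

/-- Fröhlich polaron: the form of `ℋ_z = 𝒦₀ + ∑ⱼ 𝒱_z(xⱼ) + ‖z‖²` with `κ = 1` and
`𝒱_z = √α (𝒱_< + ∇·𝒱_>) = √α (𝒱_< + [∇, 𝒱_>])`; the commutator is a form on `Q`, namely
`⟨f|[∂ᵢ, c]|g⟩ = -⟨∂ᵢ f|c|g⟩ - ⟨f|c|∂ᵢ g⟩`.  The cutoff `r > 0` is arbitrary. -/
def polaronForm (α r : ℝ) (z : PolaronSpace d) (u v : FormDomain (fun _ : Fin N => (1 : ℝ)) W) :
    ℂ :=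
  freeForm u v
    + ((√α : ℝ) : ℂ) * ∑ j,
      (mulForm (fun x => (polaronLowField r z (pos x j) : ℂ)) (u.1 .state) (v.1 .state)
        - ∑ i, (mulForm (fun x => (polaronHighField r z i (pos x j) : ℂ))
              (u.1 (.grad (j, i))) (v.1 .state)
            + mulForm (fun x => (polaronHighField r z i (pos x j) : ℂ))
              (u.1 .state) (v.1 (.grad (j, i)))))
    + ((‖z‖ ^ 2 : ℝ) : ℂ) * inner ℂ (u.1 .state) (v.1 .state)

/-- The kinetic coefficients `1 / (2 mⱼ)`. -/
def massCoeff (m : Fin N → ℝ) (j : Fin N) : ℝ := 1 / (2 * m j)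

/-- `√κⱼ (-i ∂_{j,i} + e a_{z,j,i}(xⱼ)) ψ`. -/
def covDeriv {W : Cfg N 3 → ℝ} (ω : Dispersion 𝔥)
    (lam : Fin N → Fin 3 → EuclideanSpace ℝ (Fin 3) → 𝔥) (e : ℝ) (z : ω.FieldSpace)
    (u : FormDomain κ W) (p : Fin N × Fin 3) (x : Cfg N 3) : ℂ :=
  -Complex.I * u.1 (.grad p) x
    + ((√(κ p.1) * e * ω.classicalField (lam p.1 p.2) z (pos x p.1) : ℝ) : ℂ) * u.1 .state x

/-- Pauli-Fierz model: the form of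
`ℋ_z = ∑ⱼ (1 / (2 mⱼ)) (-i ∇ⱼ + e a_{z,j}(xⱼ))² + 𝒲 + ⟨z|ω|z⟩`, with
`a_{z,j}(x) = 2 Re ⟨z|λⱼ(x)⟩`. -/
def pauliFierzForm {W : Cfg N 3 → ℝ} (ω : Dispersion 𝔥)
    (lam : Fin N → Fin 3 → EuclideanSpace ℝ (Fin 3) → 𝔥) (e : ℝ) (z : ω.FieldSpace)
    (u v : FormDomain κ W) : ℂ :=
  (∑ p, ∫ x, starRingEnd ℂ (covDeriv ω lam e z u p x) * covDeriv ω lam e z v p x)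
    + inner ℂ (u.1 .pot) (v.1 .pot)
    + ((‖z‖ ^ 2 : ℝ) : ℂ) * inner ℂ (u.1 .state) (v.1 .state)

end Models

end QuasiClassical

end

/-! Write `R` for `T^{-1/2}`, `A z` for `R ℋ_z R`, and `E` for the minimal energy. Everything is
reduced to one bounded operator. If `h = ℋ_z - E ≥ 0` and `G = R h R`, then `K = R (G + R²)⁻¹ R` is
the resolvent `(h + 1)⁻¹`, with `0 ≤ K ≤ 1`, and a state `ρ` minimizes at `z` exactly when `ρ K = 1`
(`isGqcMinimizer_iff`). If the lift `ρT` kills `G`, then the algebra of `K` gives `ρ K = ρT (R K R)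
= ρT (R²) = 1`. Conversely, if `ρ K = 1`, then Cauchy-Schwarz gives `ρ (K B K) = ρ B`. This identity
produces a lift, whose energy for `h` is `ρ (K - K²) = 0`.

The minimizing states at a fixed `z` therefore form a weak-* compact face `{ρ | ρ K = 1}` of the
state space. By Krein-Milman each is in the closed convex hull of the extreme points of the face,
and these are pure (`mem_closure_convexHull_pure`).

The three infima agree. Dirac measures bound the measure problem by the problem over states, and
pure states are states. In the other direction, unit vectors in the range of `R` define pure states,
so a lower bound over pure states is an operator inequality `A z ≥ c R²` for every `z`, which can be
integrated against any measure (`shifted_nonneg`, `le_gsvmInf`).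

For a minimizing measure, the lift has a weak-* density `ρT` (`exists_isWeakDensity`), and `ρT z`
kills `G` almost everywhere because the integrand is nonnegative with integral zero. Lifting does
not pass directly to the given density `ρ`: the relation between `ρT` and `ρ` holds almost
everywhere for each operator, with an exceptional set that may depend on it. Instead the single
norm-measurable family `z ↦ K z` is integrated: `∫ ρ z (K z) = ∫ ρT z (R K R) = ∫ ρT z (R²) = 1`,
while `ρ z (K z) ≤ 1`, so equality holds almost everywhere (`ae_map_shiftedResolvent`).

The models enter only through a bounded coercive form, an injective `J` with dense range, and a
countably generated σ-algebra on the field space (`minimizerEquivalence_of_coercive`). All three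
forms are the form of `T` plus first-order terms with bounded coefficients
(`minimizerEquivalence_of_perturbation`). -/

noncomputable section

open MeasureTheory Filter Topology
open scoped ComplexOrder InnerProductSpace ENNReal

namespace QuasiClassical

/-! ### Positive functionals, their weak-* density and their supports. -/

section Functionals

variable {H : Type*} [NormedAddCommGroup H] [InnerProductSpace ℂ H]

/-- The finite rank functional `B ↦ ⟨x, B y⟩`. -/
def vecFunctional (x y : H) : StrongDual ℂ (BOp H) :=
  (innerSL ℂ x) ∘L (ContinuousLinearMap.apply ℂ H y)

@[simp]
theorem vecFunctional_apply (x y : H) (B : BOp H) : vecFunctional x y B = inner ℂ x (B y) := rfl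

theorem span_vecFunctional_subset :
    (Submodule.span ℂ (Set.range fun p : H × H => StrongDual.toWeakDual (vecFunctional p.1 p.2)) :
      Set (WeakDual ℂ (BOp H))) ⊆ traceClassFunctionals H := by
  intro F hF
  obtain ⟨k, c, g, rfl⟩ := (Submodule.mem_span_set').mp hF
  choose p hp using fun i => (g i).2
  -- A finite combination is a trace class series padded with zeros; the coefficients go into the
  -- second vectors.
  refine ⟨fun n => if h : n < k then (p ⟨n, h⟩).1 else 0,
    fun n => if h : n < k then c ⟨n, h⟩ • (p ⟨n, h⟩).2 else 0, ?_, ?_, fun B => ?_⟩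
  · refine summable_of_ne_finset_zero (s := Finset.range k) fun n hn => ?_
    simp [Finset.mem_range.not.mp hn]
  · refine summable_of_ne_finset_zero (s := Finset.range k) fun n hn => ?_
    simp [Finset.mem_range.not.mp hn]
  · rw [tsum_eq_sum (s := Finset.range k)]
    · rw [← Fin.sum_univ_eq_sum_range (fun n => inner ℂ (if h : n < k then (p ⟨n, h⟩).1 else 0)
        (B (if h : n < k then c ⟨n, h⟩ • (p ⟨n, h⟩).2 else 0)))]
      have : ∀ s : Finset (Fin k), (∑ i ∈ s, c i • (g i : WeakDual ℂ (BOp H))) B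
          = ∑ i ∈ s, c i * (g i : WeakDual ℂ (BOp H)) B := by
        intro s
        induction s using Finset.cons_induction with
        | empty => rfl
        | cons i s hi ih =>
          rw [Finset.sum_cons, Finset.sum_cons, ← ih]
          rfl
      rw [this]
      refine Finset.sum_congr rfl fun i _ => ?_
      rw [← hp i]
      simp
    · intro n hn
      simp [Finset.mem_range.not.mp hn]

/-- In a weak topology, a point outside the closure of a subspace is separated from the subspace by
an evaluation. -/
theorem exists_eval_ne_zero_of_notMem_closure {E F : Type*} [AddCommGroup E] [Module ℂ E]
    [AddCommGroup F] [Module ℂ F] (b : E →ₗ[ℂ] F →ₗ[ℂ] ℂ) (P : Submodule ℂ (WeakBilin b))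
    (x : WeakBilin b) (hx : x ∉ closure (P : Set (WeakBilin b))) :
    ∃ y : F, (∀ g ∈ P, b g y = 0) ∧ b x y ≠ 0 := by
  let : Module ℝ E := Module.complexToReal E
  have : IsScalarTower ℝ ℂ E := inferInstance
  have : IsScalarTower ℝ ℂ (WeakBilin b) := inferInstanceAs (IsScalarTower ℝ ℂ E)
  have : ContinuousSMul ℝ (WeakBilin b) := IsScalarTower.continuousSMul ℂ
  have hconv : Convex ℝ (closure (P : Set (WeakBilin b))) :=
    (P.restrictScalars ℝ).convex.closure
  obtain ⟨f, u, hfu, huF⟩ :=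
    RCLike.geometric_hahn_banach_closed_point (𝕜 := ℂ) hconv isClosed_closure hx
  obtain ⟨y, hy⟩ := LinearMap.dualEmbedding_surjective b f
  have hf : ∀ g : WeakBilin b, f g = b g y := fun g => by rw [← hy]; rfl
  have h0 : 0 < u := by
    have := hfu 0 (subset_closure P.zero_mem)
    simpa using this
  refine ⟨y, fun g hg => ?_, fun h => ?_⟩
  · by_contra hne
    set w := b g y with hw
    -- This multiple of `g` is chosen so that `f` takes the value `u` on it, against the strict
    -- bound on `P`.
    have hmem : ((u / ‖w‖ ^ 2 : ℝ) * starRingEnd ℂ w : ℂ) • g ∈ P := P.smul_mem _ hg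
    have h1 := hfu _ (subset_closure hmem)
    rw [map_smul, hf, ← hw, smul_eq_mul,
      mul_assoc, mul_comm (starRingEnd ℂ w), Complex.mul_conj, Complex.normSq_eq_norm_sq,
      ← Complex.ofReal_mul, div_mul_cancel₀ _ (by simpa using hne)] at h1
    simp at h1
  · rw [hf, h] at huF
    simp at huF
    linarith

/-- The trace class functionals are weak-* dense. -/
theorem mem_closure_traceClassFunctionals (F : WeakDual ℂ (BOp H)) :
    F ∈ closure (traceClassFunctionals H) := by
  refine closure_mono span_vecFunctional_subset ?_
  by_contra hF
  obtain ⟨B, hB, hFB⟩ := exists_eval_ne_zero_of_notMem_closure (topDualPairing ℂ (BOp H)) _ F hF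
  -- The functional `⟨B y, B y⟩` has finite rank, so the separating operator vanishes.
  have hB0 : B = 0 := by
    ext y
    have hmem : StrongDual.toWeakDual (vecFunctional (B y) y) ∈ Submodule.span ℂ
        (Set.range fun p : H × H => StrongDual.toWeakDual (vecFunctional p.1 p.2)) :=
      Submodule.subset_span ⟨(B y, y), rfl⟩
    exact inner_self_eq_zero.mp (hB _ hmem)
  exact hFB (by rw [hB0, map_zero])

/-- Krein-Milman is applied over `ℝ`, so the real module structure on the complex dual has to be
fixed explicitly. -/
theorem locallyConvexSpace_weakDual :
    @LocallyConvexSpace ℝ (WeakDual ℂ (BOp H)) _ _ _ (WeakDual.instModule' ℝ) _ :=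
  inferInstanceAs (LocallyConvexSpace ℝ (WeakBilin (topDualPairing ℂ (BOp H))))

variable [CompleteSpace H]

/-- The closure condition is void, since finite rank functionals are already weak-* dense. -/
theorem mem_genPositive_iff {ρ : StrongDual ℂ (BOp H)} :
    ρ ∈ genPositive H ↔ ∀ B : BOp H, 0 ≤ B → 0 ≤ ρ B :=
  ⟨fun h => h.2, fun h => ⟨mem_closure_traceClassFunctionals _, h⟩⟩

theorem mem_genStates_iff {ρ : StrongDual ℂ (BOp H)} :
    ρ ∈ genStates H ↔ (∀ B : BOp H, 0 ≤ B → 0 ≤ ρ B) ∧ ρ 1 = 1 := by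
  refine ⟨fun h => ⟨h.1.2, ?_⟩, fun h => ⟨mem_genPositive_iff.mpr h.1, ?_⟩⟩
  · rw [← norm_eq_of_positive h.1.2, h.2, Complex.ofReal_one]
  · have := norm_eq_of_positive h.1
    rw [h.2] at this
    exact_mod_cast this

/-- Cauchy-Schwarz for the GNS semi-inner product of `ρ`: `√D` is a null vector, and `D B = √D (√D
B)`. -/
theorem map_mul_eq_zero_of_nonneg {ρ : StrongDual ℂ (BOp H)}
    (hρ : ∀ B : BOp H, 0 ≤ B → 0 ≤ ρ B) {D : BOp H} (hD : 0 ≤ D) (h0 : ρ D = 0) (B : BOp H) :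
    ρ (D * B) = 0 ∧ ρ (B * D) = 0 := by
  set f : BOp H →ₚ[ℂ] ℂ := PositiveLinearMap.mk₀ ρ.toLinearMap hρ with hf
  have hfρ : ∀ X, f X = ρ X := fun X => rfl
  set s := CFC.sqrt D with hs
  have hss : s * s = D := CFC.sqrt_mul_sqrt_self D hD
  have hsa : star s = s := (CFC.sqrt_nonneg D).isSelfAdjoint.star_eq
  have hn : ‖f.toPreGNS s‖ = 0 := by
    rw [PositiveLinearMap.preGNS_norm_def, PositiveLinearMap.ofPreGNS_toPreGNS, hsa, hss, hfρ, h0]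
    simp
  constructor
  · have h1 := norm_inner_le_norm (𝕜 := ℂ) (f.toPreGNS s) (f.toPreGNS (s * B))
    rw [hn, zero_mul, PositiveLinearMap.preGNS_inner_def, PositiveLinearMap.ofPreGNS_toPreGNS,
      PositiveLinearMap.ofPreGNS_toPreGNS, hsa, ← mul_assoc, hss, hfρ] at h1
    exact norm_le_zero_iff.mp h1
  · have h1 := norm_inner_le_norm (𝕜 := ℂ) (f.toPreGNS (star (B * s))) (f.toPreGNS s)
    rw [hn, mul_zero, PositiveLinearMap.preGNS_inner_def, PositiveLinearMap.ofPreGNS_toPreGNS,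
      PositiveLinearMap.ofPreGNS_toPreGNS, star_star, mul_assoc, hss, hfρ] at h1
    exact norm_le_zero_iff.mp h1

/-- A positive functional that takes its maximal value at `K ≤ 1` is supported on `K`. -/
theorem map_compress_eq {ρ : StrongDual ℂ (BOp H)}
    (hρ : ∀ B : BOp H, 0 ≤ B → 0 ≤ ρ B) {K : BOp H} (hK : K ≤ 1) (h1 : ρ K = ρ 1) (B : BOp H) :
    ρ (K * B * K) = ρ B := by
  have hD : 0 ≤ 1 - K := sub_nonneg.mpr hK
  have h0 : ρ (1 - K) = 0 := by rw [map_sub, h1, sub_self]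
  have h2 := (map_mul_eq_zero_of_nonneg hρ hD h0 (B * K)).1
  have h3 := (map_mul_eq_zero_of_nonneg hρ hD h0 B).2
  rw [sub_mul, one_mul, map_sub, sub_eq_zero] at h2
  rw [mul_sub, mul_one, map_sub, sub_eq_zero] at h3
  rw [mul_assoc, ← h2, ← h3]

/-- Conjugation of a functional by `C`: `B ↦ ρ (C† B C)`. -/
def conjFunctional (ρ : StrongDual ℂ (BOp H)) (C : BOp H) : StrongDual ℂ (BOp H) :=
  ρ ∘L (((ContinuousLinearMap.mul ℂ (BOp H)) (star C)).comp
    ((ContinuousLinearMap.mul ℂ (BOp H)).flip C))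

@[simp]
theorem conjFunctional_apply (ρ : StrongDual ℂ (BOp H)) (C B : BOp H) :
    conjFunctional ρ C B = ρ (star C * B * C) := by
  simp [conjFunctional, mul_assoc]

theorem conjFunctional_nonneg {ρ : StrongDual ℂ (BOp H)} (hρ : ∀ B : BOp H, 0 ≤ B → 0 ≤ ρ B)
    (C : BOp H) (B : BOp H) (hB : 0 ≤ B) : 0 ≤ conjFunctional ρ C B := by
  rw [conjFunctional_apply]
  exact hρ _ (star_left_conjugate_nonneg hB C)

theorem vecFunctional_nonneg (x : H) (B : BOp H) (hB : 0 ≤ B) : 0 ≤ vecFunctional x x B := by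
  rw [vecFunctional_apply]
  exact ((ContinuousLinearMap.nonneg_iff_isPositive B).mp hB).inner_nonneg_right x

/-- Unit vectors define pure generalized states. -/
theorem vecFunctional_mem_genPureStates {x : H} (hx : ‖x‖ = 1) :
    vecFunctional x x ∈ genPureStates H := by
  have hxx : inner ℂ x x = (1 : ℂ) := by rw [inner_self_eq_norm_sq_to_K, hx]; simp
  have hstate : vecFunctional x x ∈ genStates H :=
    mem_genStates_iff.mpr ⟨vecFunctional_nonneg x, hxx⟩
  set P : BOp H := InnerProductSpace.rankOne ℂ x x with hP
  have hPapp : ∀ y, P y = inner ℂ x y • x := fun y => by simp [hP]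
  have hP1 : 0 ≤ 1 - P := by
    rw [ContinuousLinearMap.nonneg_iff_isPositive, ContinuousLinearMap.isPositive_iff_complex]
    intro y
    have : inner ℂ ((1 - P) y) y = ((‖y‖ ^ 2 - ‖inner ℂ x y‖ ^ 2 : ℝ) : ℂ) := by
      rw [sub_apply, inner_sub_left, hPapp, inner_smul_left,
        mul_comm, Complex.mul_conj, Complex.normSq_eq_norm_sq]
      simp [inner_self_eq_norm_sq_to_K]
    rw [this]
    refine ⟨rfl, ?_⟩
    have h2 := norm_inner_le_norm (𝕜 := ℂ) x y
    rw [hx, one_mul] at h2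
    simp only [RCLike.re_to_complex, Complex.ofReal_re]
    nlinarith [norm_nonneg (inner ℂ x y)]
  rw [genPureStates, mem_extremePoints_iff_left]
  refine ⟨hstate, fun ρ₁ h₁ ρ₂ h₂ hmem => ?_⟩
  obtain ⟨s, t, hs, ht, hst, hsum⟩ := hmem
  obtain ⟨p₁, n₁⟩ := mem_genStates_iff.mp h₁
  obtain ⟨p₂, n₂⟩ := mem_genStates_iff.mp h₂
  -- The vector state vanishes on `1 - P ≥ 0`, hence so does each component of a convex
  -- decomposition.
  have h0 : ρ₁ (1 - P) = 0 := by
    have h3 := congrArg (fun F : StrongDual ℂ (BOp H) => F (1 - P)) hsum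
    have h4 : vecFunctional x x (1 - P) = 0 := by
      rw [vecFunctional_apply, sub_apply, hPapp, hxx, one_smul]
      exact (congrArg _ (sub_self x)).trans (inner_zero_right x)
    simp only [h4, add_apply, smul_apply,
      Complex.real_smul] at h3
    have h5 := p₁ _ hP1
    have h6 := p₂ _ hP1
    obtain ⟨a5, b5⟩ := Complex.nonneg_iff.mp h5
    obtain ⟨a6, b6⟩ := Complex.nonneg_iff.mp h6
    have h7 := congrArg Complex.re h3
    simp at h7
    have h8 : (ρ₁ (1 - P)).re = 0 := by
      simp only [map_sub, Complex.sub_re] at *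
      nlinarith
    exact Complex.ext h8 b5.symm
  have hK : ρ₁ P = ρ₁ 1 := by
    rw [map_sub, sub_eq_zero] at h0; exact h0.symm
  ext B
  rw [← map_compress_eq p₁ (sub_nonneg.mp hP1) hK B]
  -- Compressing to the line through `x` leaves only the vector state, so a state supported on `P`
  -- is determined.
  have : P * B * P = inner ℂ x (B x) • P := by
    ext y
    simp only [mul_apply_eq_comp, hPapp, map_smul,
      smul_apply, smul_smul, mul_comm]
  rw [this, map_smul, hK, n₁]
  simp

end Functionals

/-! ### Faces `{ρ | ρ K = 1}` of the state space and Krein-Milman. -/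

section Faces

variable {H : Type*} [NormedAddCommGroup H] [InnerProductSpace ℂ H] [CompleteSpace H]

/-- The states `ρ` with `ρ K = 1`. -/
def stateFace (K : BOp H) : Set (StrongDual ℂ (BOp H)) := {ρ | ρ ∈ genStates H ∧ ρ K = 1}

/-- Banach-Alaoglu. Normalization is expressed by `F 1 = 1` because, unlike the norm, evaluations
are weak-* continuous. -/
theorem isCompact_toWeakDual_image_stateFace (K : BOp H) :
    IsCompact (StrongDual.toWeakDual '' stateFace K) := by
  have heq : StrongDual.toWeakDual '' stateFace K =
      {F : WeakDual ℂ (BOp H) | (∀ B : BOp H, 0 ≤ B → 0 ≤ F B) ∧ F 1 = 1 ∧ F K = 1} := by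
    ext F
    constructor
    · rintro ⟨ρ, ⟨h1, h2⟩, rfl⟩
      exact ⟨(mem_genStates_iff.mp h1).1, (mem_genStates_iff.mp h1).2, h2⟩
    · rintro ⟨h1, h2, h3⟩
      exact ⟨WeakDual.toStrongDual F, ⟨mem_genStates_iff.mpr ⟨h1, h2⟩, h3⟩, rfl⟩
  refine WeakDual.isCompact_of_bounded_of_closed ?_ ?_
  · refine (Metric.isBounded_closedBall (x := (0 : StrongDual ℂ (BOp H))) (r := 1)).subset ?_
    rintro _ ⟨ρ, ⟨h1, -⟩, rfl⟩
    exact mem_closedBall_zero_iff.mpr h1.2.le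
  · rw [heq]
    simp only [Set.ofPred_and, Set.ofPred_forall]
    refine IsClosed.inter (isClosed_iInter fun B => isClosed_iInter fun _ => ?_) (IsClosed.inter ?_ ?_)
    · exact isClosed_le continuous_const (WeakDual.eval_continuous B)
    · exact isClosed_eq (WeakDual.eval_continuous 1) continuous_const
    · exact isClosed_eq (WeakDual.eval_continuous K) continuous_const

theorem convex_toWeakDual_image_stateFace (K : BOp H) :
    Convex ℝ (StrongDual.toWeakDual '' stateFace K) := by
  rintro _ ⟨ρ, ⟨h1, h2⟩, rfl⟩ _ ⟨σ, ⟨h3, h4⟩, rfl⟩ s t hs ht hst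
  refine ⟨s • ρ + t • σ, ⟨mem_genStates_iff.mpr ⟨fun B hB => ?_, ?_⟩, ?_⟩, rfl⟩
  · have a := (mem_genStates_iff.mp h1).1 B hB
    have b := (mem_genStates_iff.mp h3).1 B hB
    simp only [add_apply, smul_apply, Complex.real_smul]
    have hs' : (0 : ℂ) ≤ s := by exact_mod_cast hs
    have ht' : (0 : ℂ) ≤ t := by exact_mod_cast ht
    positivity
  · have a := (mem_genStates_iff.mp h1).2
    have b := (mem_genStates_iff.mp h3).2
    simp only [add_apply, smul_apply, Complex.real_smul, a,
      b, mul_one]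
    exact_mod_cast hst
  · simp only [add_apply, smul_apply, Complex.real_smul, h2,
      h4, mul_one]
    exact_mod_cast hst

/-- As `K ≤ 1`, the value `1` is the maximum of `ρ ↦ ρ K` on states, so both components of a
decomposition attain it. The set is a face, and extreme points of a face are extreme in the whole.
-/
theorem extremePoints_toWeakDual_image_stateFace_subset {K : BOp H} (hK : K ≤ 1) :
    (StrongDual.toWeakDual '' stateFace K).extremePoints ℝ ⊆
      StrongDual.toWeakDual '' {σ | σ ∈ genPureStates H ∧ σ K = 1} := by
  intro F hF
  obtain ⟨⟨ρ, hρ, rfl⟩, hext⟩ := mem_extremePoints_iff_left.mp hF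
  refine ⟨ρ, ⟨mem_extremePoints_iff_left.mpr ⟨hρ.1, fun ρ₁ h₁ ρ₂ h₂ hmem => ?_⟩, hρ.2⟩, rfl⟩
  obtain ⟨s, t, hs, ht, hst, hsum⟩ := hmem
  obtain ⟨p₁, n₁⟩ := mem_genStates_iff.mp h₁
  obtain ⟨p₂, n₂⟩ := mem_genStates_iff.mp h₂
  have hD : 0 ≤ 1 - K := sub_nonneg.mpr hK
  have h3 := congrArg (fun F : StrongDual ℂ (BOp H) => F K) hsum
  simp only [hρ.2, add_apply, smul_apply,
      Complex.real_smul] at h3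
  obtain ⟨a5, b5⟩ := Complex.nonneg_iff.mp (p₁ _ hD)
  obtain ⟨a6, b6⟩ := Complex.nonneg_iff.mp (p₂ _ hD)
  have h7 := congrArg Complex.re h3
  simp only [map_sub, n₁, n₂, Complex.sub_re, Complex.one_re, Complex.sub_im, Complex.one_im]
    at a5 b5 a6 b6
  simp at h7
  have k₁ : ρ₁ K = 1 := Complex.ext (by simp; nlinarith) (by simp; linarith)
  have k₂ : ρ₂ K = 1 := Complex.ext (by simp; nlinarith) (by simp; linarith)
  have := hext _ ⟨ρ₁, ⟨h₁, k₁⟩, rfl⟩ _ ⟨ρ₂, ⟨h₂, k₂⟩, rfl⟩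
    ⟨s, t, hs, ht, hst, by rw [← hsum]; rfl⟩
  exact StrongDual.toWeakDual.injective this

/-- A state with `ρ K = 1` is in the weak-* closed convex hull of the pure states with this
property. -/
theorem mem_closure_convexHull_pure {K : BOp H} (hK : K ≤ 1) {ρ : StrongDual ℂ (BOp H)}
    (hρ : ρ ∈ stateFace K) :
    StrongDual.toWeakDual ρ ∈ closure (convexHull ℝ
      (StrongDual.toWeakDual '' {σ | σ ∈ genPureStates H ∧ σ K = 1})) := by
  have h := @closure_convexHull_extremePoints (WeakDual ℂ (BOp H)) WeakDual.instAddCommGroup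
    (WeakDual.instModule' ℝ) _ _ _ (WeakDual.instContinuousSMul ℝ) locallyConvexSpace_weakDual _
    (isCompact_toWeakDual_image_stateFace K) (convex_toWeakDual_image_stateFace K)
  refine closure_mono (convexHull_mono (extremePoints_toWeakDual_image_stateFace_subset hK)) ?_
  exact h.ge ⟨ρ, hρ, rfl⟩

theorem exists_pure_of_mem_stateFace {K : BOp H} (hK : K ≤ 1) {ρ : StrongDual ℂ (BOp H)}
    (hρ : ρ ∈ stateFace K) : ∃ σ ∈ genPureStates H, σ K = 1 := by
  obtain ⟨F, hF⟩ := @IsCompact.extremePoints_nonempty (WeakDual ℂ (BOp H))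
    WeakDual.instAddCommGroup (WeakDual.instModule' ℝ) _ _ _ (WeakDual.instContinuousSMul ℝ)
    locallyConvexSpace_weakDual _ (isCompact_toWeakDual_image_stateFace K) ⟨_, ρ, hρ, rfl⟩
  obtain ⟨σ, hσ, -⟩ := extremePoints_toWeakDual_image_stateFace_subset hK hF
  exact ⟨σ, hσ.1, hσ.2⟩

end Faces

/-! ### Weak-* densities of generalized state-valued measures. -/

section Density

open ProbabilityTheory

variable {X : Type*} [MeasurableSpace X] {H : Type*} [NormedAddCommGroup H]
  [InnerProductSpace ℂ H] [CompleteSpace H]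

namespace GenMeasure

instance (n : GenMeasure X H) : IsFiniteMeasure n.normMeasure :=
  ⟨by rw [n.normMeasure_apply MeasurableSet.univ]; exact ENNReal.ofReal_lt_top⟩

theorem normMeasure_real (n : GenMeasure X H) {S : Set X} (hS : MeasurableSet S) :
    n.normMeasure.real S = ‖n.vm S‖ := by
  rw [Measure.real, n.normMeasure_apply hS, ENNReal.toReal_ofReal (norm_nonneg _)]

/-- The measure `S ↦ (B ↦ n(S)[C† B C])`. -/
def conj (n : GenMeasure X H) (C : BOp H) : GenMeasure X H where
  vm := n.vm.mapRange
    (ContinuousLinearMap.precomp ℂ (((ContinuousLinearMap.mul ℂ (BOp H)) (star C)).comp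
      ((ContinuousLinearMap.mul ℂ (BOp H)).flip C)) :
        StrongDual ℂ (BOp H) →L[ℂ] StrongDual ℂ (BOp H)).toLinearMap.toAddMonoidHom
    (ContinuousLinearMap.continuous _)
  mem_genPositive S hS := mem_genPositive_iff.mpr
    (conjFunctional_nonneg (n.mem_genPositive S hS).2 C)

theorem conj_apply (n : GenMeasure X H) (C B : BOp H) (S : Set X) :
    (n.conj C).vm S B = n.vm S (star C * B * C) :=
  conjFunctional_apply (n.vm S) C B

theorem conj_normMeasure_apply (n : GenMeasure X H) (C : BOp H) {S : Set X}
    (hS : MeasurableSet S) :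
    (n.conj C).normMeasure S = ENNReal.ofReal (n.vm S (star C * C)).re := by
  rw [normMeasure_apply _ hS, norm_apply_eq _ hS, conj_apply, mul_one]

theorem apply_eq_ofReal_re (n : GenMeasure X H) {S : Set X} (hS : MeasurableSet S) {B : BOp H}
    (hB : 0 ≤ B) : n.vm S B = ((n.vm S B).re : ℂ) :=
  Complex.ext (by simp)
    (by simpa using ((Complex.nonneg_iff.mp ((n.mem_genPositive S hS).2 B hB)).2).symm)

theorem re_apply_nonneg (n : GenMeasure X H) {S : Set X} (hS : MeasurableSet S) {B : BOp H}
    (hB : 0 ≤ B) : 0 ≤ (n.vm S B).re :=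
  (Complex.nonneg_iff.mp ((n.mem_genPositive S hS).2 B hB)).1

variable [MeasurableSpace.CountablyGenerated X]

/-- For `0 ≤ B ≤ 1`, the quotients `n(P)[B] / ‖n(P)‖` over the cells `P` of a refining sequence of
partitions converge almost everywhere to a density of `S ↦ n(S)[B]`. -/
theorem exists_scalar_density (n : GenMeasure X H) {B : BOp H} (hB : 0 ≤ B) (hB1 : B ≤ 1) :
    ∃ f : X → ℝ, Integrable f n.normMeasure ∧
      (∀ S, MeasurableSet S → n.vm S B = ((∫ z in S, f z ∂n.normMeasure : ℝ) : ℂ)) ∧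
      ∀ᵐ z ∂n.normMeasure, Tendsto
        (fun k => (n.vm (MeasurableSpace.countablePartitionSet k z) B).re /
          ‖n.vm (MeasurableSpace.countablePartitionSet k z)‖) atTop (𝓝 (f z)) := by
  have hss : star (CFC.sqrt B) * CFC.sqrt B = B := by
    rw [(CFC.sqrt_nonneg B).isSelfAdjoint.star_eq, CFC.sqrt_mul_sqrt_self B hB]
  -- Conjugation by `√B` turns `S ↦ n(S)[B]` into a norm measure, so its countable additivity is
  -- already available.
  set ν := (n.conj (CFC.sqrt B)).normMeasure with hν
  have hνS : ∀ S, MeasurableSet S → ν S = ENNReal.ofReal (n.vm S B).re := fun S hS => by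
    rw [hν, conj_normMeasure_apply _ _ hS, hss]
  have hmap : Measurable fun x : X => (x, ()) := by fun_prop
  -- A trivial second factor puts the pair of measures into the setting of kernel densities, whose
  -- construction is the martingale of quotients along `countablePartitionSet`.
  set κ : Kernel Unit (X × Unit) := Kernel.const Unit (ν.map fun x => (x, ())) with hκ
  set η : Kernel Unit X := Kernel.const Unit n.normMeasure with hη
  have hκS : ∀ S, MeasurableSet S → κ () (S ×ˢ Set.univ) = ENNReal.ofReal (n.vm S B).re := by
    intro S hS
    rw [hκ, Kernel.const_apply, Measure.map_apply hmap (hS.prod MeasurableSet.univ), ← hνS S hS]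
    congr 1
    ext x
    simp
  have hle : κ.fst ≤ η := by
    intro a
    rw [Measure.le_iff]
    intro S hS
    rw [Kernel.fst_apply' _ _ hS]
    have : {p : X × Unit | p.1 ∈ S} = S ×ˢ Set.univ := by ext p; simp
    rw [this, hκS S hS, hη, Kernel.const_apply, n.normMeasure_apply hS, n.norm_apply_eq hS]
    refine ENNReal.ofReal_le_ofReal ?_
    have := n.re_apply_nonneg hS (sub_nonneg.mpr hB1)
    rw [map_sub, Complex.sub_re] at this
    linarith
  refine ⟨fun z => κ.density η () z Set.univ,
    Kernel.integrable_density hle () MeasurableSet.univ, fun S hS => ?_, ?_⟩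
  · have h := Kernel.setIntegral_density hle () MeasurableSet.univ hS
    rw [hη, Kernel.const_apply, ← hη] at h
    rw [h, n.apply_eq_ofReal_re hS hB, Measure.real, hκS S hS,
      ENNReal.toReal_ofReal (n.re_apply_nonneg hS hB)]
  · have h := Kernel.tendsto_m_density hle () MeasurableSet.univ
    filter_upwards [h] with z hz
    refine hz.congr fun k => ?_
    have hP := MeasurableSpace.measurableSet_countablePartitionSet k z
    rw [Kernel.densityProcess, hκS _ hP, hη, Kernel.const_apply, n.normMeasure_apply hP,
      ENNReal.toReal_div, ENNReal.toReal_ofReal (norm_nonneg _),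
      ENNReal.toReal_ofReal (n.re_apply_nonneg hP hB)]

/-- Every generalized state-valued measure has a weak-* density. -/
theorem exists_isWeakDensity (n : GenMeasure X H) : ∃ ρ, IsWeakDensity n ρ := by
  set P : ℕ → X → Set X := fun k z => MeasurableSpace.countablePartitionSet k z with hPdef
  have hP : ∀ k z, MeasurableSet (P k z) := fun k z =>
    MeasurableSpace.measurableSet_countablePartitionSet k z
  -- Normalized value of `n` on the cell of generation `k` containing `z`. A cell of norm zero gives
  -- the zero functional, so the norm is always at most `1`.
  set ap : X → ℕ → WeakDual ℂ (BOp H) := fun z k =>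
    StrongDual.toWeakDual (((‖n.vm (P k z)‖⁻¹ : ℝ) : ℂ) • n.vm (P k z)) with hap
  have hapB : ∀ z k B, ap z k B = ((‖n.vm (P k z)‖⁻¹ : ℝ) : ℂ) * n.vm (P k z) B :=
    fun z k B => rfl
  -- One ultrafilter gives a limit functional at every `z`, for all operators at once. Martingale
  -- convergence then identifies `F z B` almost everywhere for each separate `B`, so no separability
  -- of the bounded operators is needed.
  have hlim : ∀ z, ∃ F : WeakDual ℂ (BOp H), Tendsto (ap z) (hyperfilter ℕ : Filter ℕ) (𝓝 F) := by
    intro z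
    obtain ⟨F, -, hF⟩ := (WeakDual.isCompact_closedBall (𝕜 := ℂ) (E := BOp H) 0 1).ultrafilter_le_nhds
      ((hyperfilter ℕ).map (ap z)) (by
        rw [le_principal_iff]
        refine Filter.mem_map.mpr (Filter.univ_mem' fun k => ?_)
        refine mem_closedBall_zero_iff.mpr ?_
        change ‖((‖n.vm (P k z)‖⁻¹ : ℝ) : ℂ) • n.vm (P k z)‖ ≤ 1
        rw [norm_smul, Complex.norm_real, norm_inv, norm_norm]
        exact inv_mul_le_one)
    exact ⟨F, hF⟩
  choose F hF using hlim
  have hFB : ∀ z B, Tendsto (fun k => ap z k B) (hyperfilter ℕ : Filter ℕ) (𝓝 (F z B)) :=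
    fun z B => ((WeakDual.eval_continuous B).tendsto (F z)).comp (hF z)
  have hpos : ∀ z (B : BOp H), 0 ≤ B → 0 ≤ F z B := by
    intro z B hB
    refine ge_of_tendsto' (hFB z B) fun k => ?_
    rw [hapB]
    refine mul_nonneg ?_ ((n.mem_genPositive _ (hP k z)).2 B hB)
    exact_mod_cast inv_nonneg.mpr (norm_nonneg _)
  have hone : ∀ B : BOp H, 0 ≤ B → B ≤ 1 → Integrable (fun z => F z B) n.normMeasure ∧
      ∀ S, MeasurableSet S → n.vm S B = ∫ z in S, F z B ∂n.normMeasure := by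
    intro B hB hB1
    obtain ⟨f, hfi, hfS, hft⟩ := n.exists_scalar_density hB hB1
    have hae : (fun z => F z B) =ᵐ[n.normMeasure] fun z => (f z : ℂ) := by
      filter_upwards [hft] with z hz
      refine tendsto_nhds_unique (hFB z B) ?_
      have h1 := ((Complex.continuous_ofReal.tendsto (f z)).comp hz).mono_left
        Nat.hyperfilter_le_atTop
      refine h1.congr fun k => ?_
      rw [hapB, n.apply_eq_ofReal_re (hP k z) hB]
      simp only [Function.comp_apply]
      push_cast
      rw [div_eq_inv_mul]
    refine ⟨hfi.ofReal.congr hae.symm, fun S hS => ?_⟩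
    rw [hfS S hS, setIntegral_congr_ae (g := fun z => (f z : ℂ)) hS (hae.mono fun z hz _ => hz)]
    exact integral_complex_ofReal.symm
  have hall : ∀ B : BOp H, Integrable (fun z => F z B) n.normMeasure ∧
      ∀ S, MeasurableSet S → n.vm S B = ∫ z in S, F z B ∂n.normMeasure := by
    intro B
    -- Positive contractions span the bounded operators, and both properties are linear in `B`.
    have hB : B ∈ Submodule.span ℂ ({B : BOp H | 0 ≤ B} ∩ Metric.closedBall 0 1) := by
      rw [CStarAlgebra.span_nonneg_inter_unitClosedBall]; trivial
    induction hB using Submodule.span_induction with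
    | mem B hB =>
      exact hone B hB.1 ((CStarAlgebra.norm_le_one_iff_of_nonneg B hB.1).mp
        (mem_closedBall_zero_iff.mp hB.2))
    | zero => simp
    | add B C _ _ hB hC =>
      simp only [map_add]
      refine ⟨hB.1.add hC.1, fun S hS => ?_⟩
      rw [hB.2 S hS, hC.2 S hS, integral_add hB.1.integrableOn hC.1.integrableOn]
    | smul c B _ hB =>
      simp only [map_smul, smul_eq_mul]
      refine ⟨hB.1.const_mul c, fun S hS => ?_⟩
      rw [hB.2 S hS, integral_const_mul]
  refine ⟨fun z => WeakDual.toStrongDual (F z), ?_, hall⟩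
  -- The two functions have equal integrals over every set because `‖n(S)‖ = n(S)[1]`.
  have h1 : (fun z => F z 1) =ᵐ[n.normMeasure] fun _ => (1 : ℂ) := by
    refine Integrable.ae_eq_of_forall_setIntegral_eq _ _ (hall 1).1 (integrable_const _)
      fun S hS _ => ?_
    rw [← (hall 1).2 S hS, ← norm_eq_of_positive (n.mem_genPositive S hS).2]
    simp [n.normMeasure_real hS]
  filter_upwards [h1] with z hz
  exact mem_genStates_iff.mpr ⟨hpos z, hz⟩

end GenMeasure

end Density

/-! ### The operator-valued integral through a weak-* density. -/

section Integration

variable {X : Type*} [MeasurableSpace X] {H : Type*} [NormedAddCommGroup H]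
  [InnerProductSpace ℂ H] [CompleteSpace H]

/-- Two additive functionals on integrable functions that are Lipschitz for the `L¹` distance
coincide if they coincide on indicators. -/
theorem eq_of_forall_indicator_eq {E : Type*} [NormedAddCommGroup E] {μ : Measure X}
    {Φ Ψ : (X → E) → ℂ} {C : ℝ}
    (hΦ : ∀ f g, Integrable f μ → Integrable g μ → Φ (f + g) = Φ f + Φ g)
    (hΨ : ∀ f g, Integrable f μ → Integrable g μ → Ψ (f + g) = Ψ f + Ψ g)
    (hΦC : ∀ f g, Integrable f μ → Integrable g μ → ‖Φ f - Φ g‖ ≤ C * ∫ x, ‖f x - g x‖ ∂μ)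
    (hΨC : ∀ f g, Integrable f μ → Integrable g μ → ‖Ψ f - Ψ g‖ ≤ C * ∫ x, ‖f x - g x‖ ∂μ)
    (hind : ∀ (c : E) (S : Set X), MeasurableSet S → μ S < ⊤ →
      Φ (S.indicator fun _ => c) = Ψ (S.indicator fun _ => c))
    {f : X → E} (hf : Integrable f μ) : Φ f = Ψ f := by
  have hcongr : ∀ {Θ : (X → E) → ℂ}, (∀ f g, Integrable f μ → Integrable g μ →
      ‖Θ f - Θ g‖ ≤ C * ∫ x, ‖f x - g x‖ ∂μ) → ∀ f g, f =ᵐ[μ] g → Integrable f μ → Θ f = Θ g := by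
    intro Θ hΘ f g hfg hf
    have h := hΘ f g hf (hf.congr hfg)
    have h0 : ∫ x, ‖f x - g x‖ ∂μ = 0 := by
      refine integral_eq_zero_of_ae ?_
      filter_upwards [hfg] with x hx
      simp [hx]
    rw [h0, mul_zero] at h
    exact sub_eq_zero.mp (norm_le_zero_iff.mp h)
  have hcont : ∀ {Θ : (X → E) → ℂ}, (∀ f g, Integrable f μ → Integrable g μ →
      ‖Θ f - Θ g‖ ≤ C * ∫ x, ‖f x - g x‖ ∂μ) → Continuous fun f : X →₁[μ] E => Θ f := by
    intro Θ hΘ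
    refine (LipschitzWith.of_dist_le' (K := C) fun f g => ?_).continuous
    rw [dist_eq_norm, dist_eq_norm, L1.norm_eq_integral_norm]
    refine (hΘ _ _ (L1.integrable_coeFn f) (L1.integrable_coeFn g)).trans (le_of_eq ?_)
    congr 1
    refine integral_congr_ae ?_
    filter_upwards [Lp.coeFn_sub f g] with x hx
    rw [hx, Pi.sub_apply]
  refine Integrable.induction (fun f => Φ f = Ψ f) (fun c S hS hμ => hind c S hS hμ) ?_ ?_ ?_ hf
  · intro f g _ hf hg h1 h2
    rw [hΦ f g hf hg, hΨ f g hf hg, h1, h2]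
  · exact isClosed_eq (hcont hΦC) (hcont hΨC)
  · intro f g hfg hf h
    rw [← hcongr hΦC f g hfg hf, ← hcongr hΨC f g hfg hf, h]

theorem norm_le_of_mem_genStates {ρ : StrongDual ℂ (BOp H)} (h : ρ ∈ genStates H) (B : BOp H) :
    ‖ρ B‖ ≤ ‖B‖ := by
  have := ρ.le_opNorm B
  rwa [h.2, one_mul] at this

namespace IsWeakDensity

variable {n : GenMeasure X H} {ρ : X → StrongDual ℂ (BOp H)}

/-- `ρ` is measurable only against each fixed operator. Simple functions reduce to that case, and
norm limits of them pass through each continuous `ρ z`. -/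
theorem aestronglyMeasurable (h : IsWeakDensity n ρ) {F : X → BOp H}
    (hF : AEStronglyMeasurable F n.normMeasure) :
    AEStronglyMeasurable (fun z => ρ z (F z)) n.normMeasure := by
  have hsimple : ∀ f : SimpleFunc X (BOp H),
      AEStronglyMeasurable (fun z => ρ z (f z)) n.normMeasure := by
    intro f
    have : (fun z => ρ z (f z)) = fun z => ∑ B ∈ f.range, (f ⁻¹' {B}).indicator (fun z => ρ z B) z := by
      funext z
      rw [Finset.sum_eq_single (f z)]
      · simp
      · intro B _ hB
        exact Set.indicator_of_notMem (fun h => hB h.symm) _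
      · intro hz
        exact absurd (f.mem_range_self z) hz
    rw [this]
    refine Finset.aestronglyMeasurable_fun_sum _ fun B _ => ?_
    exact (h.2 B).1.aestronglyMeasurable.indicator (f.measurableSet_fiber B)
  refine aestronglyMeasurable_of_tendsto_ae atTop
    (fun k => hsimple (hF.stronglyMeasurable_mk.approx k)) ?_
  filter_upwards [hF.ae_eq_mk] with z hz
  rw [hz]
  exact ((ρ z).continuous.tendsto _).comp (hF.stronglyMeasurable_mk.tendsto_approx z)

theorem integrable (h : IsWeakDensity n ρ) {F : X → BOp H} (hF : Integrable F n.normMeasure) :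
    Integrable (fun z => ρ z (F z)) n.normMeasure := by
  refine hF.norm.mono' (h.aestronglyMeasurable hF.aestronglyMeasurable) ?_
  filter_upwards [h.1] with z hz using norm_le_of_mem_genStates hz _

theorem integral_add (h : IsWeakDensity n ρ) {F G : X → BOp H} (hF : Integrable F n.normMeasure)
    (hG : Integrable G n.normMeasure) :
    ∫ z, ρ z ((F + G) z) ∂n.normMeasure =
      ∫ z, ρ z (F z) ∂n.normMeasure + ∫ z, ρ z (G z) ∂n.normMeasure := by
  rw [← MeasureTheory.integral_add (h.integrable hF) (h.integrable hG)]
  simp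

theorem norm_integral_sub_le (h : IsWeakDensity n ρ) {F G : X → BOp H}
    (hF : Integrable F n.normMeasure) (hG : Integrable G n.normMeasure) :
    ‖∫ z, ρ z (F z) ∂n.normMeasure - ∫ z, ρ z (G z) ∂n.normMeasure‖ ≤
      ∫ z, ‖F z - G z‖ ∂n.normMeasure := by
  rw [← integral_sub (h.integrable hF) (h.integrable hG)]
  refine norm_integral_le_of_norm_le (hF.sub hG).norm ?_
  filter_upwards [h.1] with z hz
  rw [← map_sub]
  exact norm_le_of_mem_genStates hz _

theorem integral_indicator (h : IsWeakDensity n ρ) (B : BOp H) {S : Set X}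
    (hS : MeasurableSet S) :
    ∫ z, ρ z (S.indicator (fun _ => B) z) ∂n.normMeasure = n.vm S B := by
  rw [(h.2 B).2 S hS, ← MeasureTheory.integral_indicator hS]
  refine integral_congr_ae (Eventually.of_forall fun z => ?_)
  by_cases hz : z ∈ S <;> simp [hz]

/-- The operator-valued integral in terms of a weak-* density. -/
theorem integral_eq (h : IsWeakDensity n ρ) {F : X → BOp H} (hF : Integrable F n.normMeasure) :
    n.integral F = ∫ z, ρ z (F z) ∂n.normMeasure := by
  refine eq_of_forall_indicator_eq (μ := n.normMeasure) (Φ := n.integral)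
    (Ψ := fun F => ∫ z, ρ z (F z) ∂n.normMeasure) (C := 1)
    (fun f g hf hg => setToFun_add _ hf hg) (fun f g hf hg => h.integral_add hf hg) ?_
    (fun f g hf hg => by rw [one_mul]; exact h.norm_integral_sub_le hf hg) ?_ hF
  · intro f g hf hg
    have h1 := norm_setToFun_le n.dominated (hf.sub hg) zero_le_one
    rw [setToFun_sub n.dominated hf hg] at h1
    refine h1.trans (le_of_eq ?_)
    rw [L1.norm_of_fun_eq_integral_norm]
    rfl
  · intro c S hS _
    rw [h.integral_indicator c hS]
    exact setToFun_indicator_const n.dominated hS (measure_ne_top _ _) c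

end IsWeakDensity

end Integration

/-! ### Comparison of a measure with its lift. -/

section Lift

variable {H : Type*} [NormedAddCommGroup H] [InnerProductSpace ℂ H] [CompleteSpace H]
  {Q : Type*} [NormedAddCommGroup Q] [InnerProductSpace ℂ Q] [CompleteSpace Q]
  {X : Type*} [MeasurableSpace X] {J : Q →L[ℂ] H} {n nT : GenMeasure X H}

/-- Test the lifting relation with `B = 1`: `‖n(S)‖ = nT(S)[R²] ≤ ‖R²‖ ‖nT(S)‖`. Integrability for
the lift therefore passes down to `n`. -/
theorem IsLift.normMeasure_le (hL : IsLift J n nT) :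
    n.normMeasure ≤ ENNReal.ofReal ‖invSqrtT J * invSqrtT J‖ • nT.normMeasure := by
  rw [Measure.le_iff]
  intro S hS
  rw [Measure.smul_apply, smul_eq_mul, n.normMeasure_apply hS, nT.normMeasure_apply hS,
    ← ENNReal.ofReal_mul (norm_nonneg _), n.norm_apply_eq hS, ← hL S hS 1, mul_one]
  refine ENNReal.ofReal_le_ofReal ((Complex.re_le_norm _).trans ?_)
  rw [mul_comm]
  exact (nT.vm S).le_opNorm _

theorem IsLift.integrable (hL : IsLift J n nT) {E : Type*} [NormedAddCommGroup E] {F : X → E}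
    (hF : Integrable F nT.normMeasure) : Integrable F n.normMeasure :=
  (hF.smul_measure ENNReal.ofReal_ne_top).mono_measure hL.normMeasure_le

/-- The defining relation of a lift for integrals. -/
theorem IsLift.integral_eq (hL : IsLift J n nT) {ρ ρT : X → StrongDual ℂ (BOp H)}
    (h : IsWeakDensity n ρ) (hT : IsWeakDensity nT ρT) {F : X → BOp H}
    (hF : Integrable F nT.normMeasure) :
    ∫ z, ρ z (F z) ∂n.normMeasure =
      ∫ z, ρT z (invSqrtT J * F z * invSqrtT J) ∂nT.normMeasure := by
  set R := invSqrtT J with hR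
  have hint : ∀ {F : X → BOp H}, Integrable F nT.normMeasure →
      Integrable (fun z => R * F z * R) nT.normMeasure := fun hF => (hF.const_mul R).mul_const R
  -- The first entry is the Lipschitz constant from comparing the two norm measures, the second that
  -- of `B ↦ R B R`.
  set C := max ‖R * R‖ (‖R‖ * ‖R‖) with hC
  refine eq_of_forall_indicator_eq (μ := nT.normMeasure)
    (Φ := fun F => ∫ z, ρ z (F z) ∂n.normMeasure)
    (Ψ := fun F => ∫ z, ρT z (R * F z * R) ∂nT.normMeasure) (C := C)
    (fun f g hf hg => h.integral_add (hL.integrable hf) (hL.integrable hg)) ?_ ?_ ?_ ?_ hF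
  · intro f g hf hg
    simp only [Pi.add_apply, mul_add, add_mul, map_add]
    exact integral_add (hT.integrable (hint hf)) (hT.integrable (hint hg))
  · intro f g hf hg
    refine (h.norm_integral_sub_le (hL.integrable hf) (hL.integrable hg)).trans ?_
    have h1 : ∫ z, ‖f z - g z‖ ∂n.normMeasure ≤
        ∫ z, ‖f z - g z‖ ∂(ENNReal.ofReal ‖R * R‖ • nT.normMeasure) :=
      integral_mono_measure hL.normMeasure_le (Eventually.of_forall fun _ => norm_nonneg _)
        ((hf.sub hg).norm.smul_measure ENNReal.ofReal_ne_top)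
    rw [integral_smul_measure, ENNReal.toReal_ofReal (norm_nonneg _), smul_eq_mul] at h1
    exact h1.trans (mul_le_mul_of_nonneg_right (le_max_left _ _)
      (integral_nonneg fun _ => norm_nonneg _))
  · intro f g hf hg
    refine (hT.norm_integral_sub_le (hint hf) (hint hg)).trans ?_
    rw [← integral_const_mul]
    refine integral_mono ((hint hf).sub (hint hg)).norm ((hf.sub hg).norm.const_mul C) fun z => ?_
    simp only [← sub_mul, ← mul_sub]
    calc ‖R * (f z - g z) * R‖ ≤ ‖R‖ * ‖f z - g z‖ * ‖R‖ :=
          (norm_mul_le _ _).trans (mul_le_mul_of_nonneg_right (norm_mul_le _ _) (norm_nonneg _))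
      _ = (‖R‖ * ‖R‖) * ‖f z - g z‖ := by ring
      _ ≤ C * ‖f z - g z‖ := mul_le_mul_of_nonneg_right (le_max_right _ _) (norm_nonneg _)
  · intro B S hS _
    rw [h.integral_indicator B hS, ← hL S hS B, ← hT.integral_indicator (R * B * R) hS]
    refine integral_congr_ae (Eventually.of_forall fun z => ?_)
    by_cases hz : z ∈ S <;> simp [hz]

end Lift

/-! ### Measures concentrated at one classical field. -/

section Dirac

variable {X : Type*} [MeasurableSpace X] [MeasurableSingletonClass X] {H : Type*}
  [NormedAddCommGroup H] [InnerProductSpace ℂ H] [CompleteSpace H]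

/-- The measure with mass `ρ` at `z`. -/
def GenMeasure.dirac (z : X) {ρ : StrongDual ℂ (BOp H)} (hρ : ρ ∈ genPositive H) :
    GenMeasure X H where
  vm := VectorMeasure.dirac z ρ
  mem_genPositive S hS := by
    by_cases hz : z ∈ S
    · rwa [VectorMeasure.dirac_apply_of_mem hS hz]
    · rw [VectorMeasure.dirac_apply_of_notMem hz]
      exact mem_genPositive_iff.mpr fun _ _ => le_rfl

theorem GenMeasure.ae_dirac (z : X) {ρ : StrongDual ℂ (BOp H)} (hρ : ρ ∈ genPositive H) :
    ∀ᵐ y ∂(GenMeasure.dirac z hρ).normMeasure, y = z := by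
  rw [ae_iff]
  change (GenMeasure.dirac z hρ).normMeasure {z}ᶜ = 0
  rw [GenMeasure.normMeasure_apply _ (MeasurableSet.singleton z).compl]
  change ENNReal.ofReal ‖VectorMeasure.dirac z ρ {z}ᶜ‖ = 0
  rw [VectorMeasure.dirac_apply_of_notMem (by simp)]
  simp

theorem GenMeasure.integrable_dirac (z : X) {ρ : StrongDual ℂ (BOp H)} (hρ : ρ ∈ genPositive H)
    (F : X → BOp H) : Integrable F (GenMeasure.dirac z hρ).normMeasure :=
  (integrable_const (F z)).congr ((GenMeasure.ae_dirac z hρ).mono fun y hy => by rw [hy])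

theorem GenMeasure.integral_dirac (z : X) {ρ : StrongDual ℂ (BOp H)} (hρ : ρ ∈ genPositive H)
    (F : X → BOp H) : (GenMeasure.dirac z hρ).integral F = ρ (F z) := by
  have h1 : F =ᵐ[(GenMeasure.dirac z hρ).normMeasure] Set.univ.indicator fun _ => F z :=
    (GenMeasure.ae_dirac z hρ).mono fun y hy => by simp [hy]
  rw [GenMeasure.integral, setToFun_congr_ae _ h1,
    setToFun_indicator_const _ MeasurableSet.univ (measure_ne_top _ _)]
  change VectorMeasure.dirac z ρ Set.univ (F z) = _
  rw [VectorMeasure.dirac_apply_of_mem MeasurableSet.univ (Set.mem_univ z)]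

end Dirac

/-! ### The operator `T^{-1/2}` and sandwiched forms. -/

section SquareRoot

variable {H : Type*} [NormedAddCommGroup H] [InnerProductSpace ℂ H] [CompleteSpace H]
  {Q : Type*} [NormedAddCommGroup Q] [InnerProductSpace ℂ Q] [CompleteSpace Q] (J : Q →L[ℂ] H)

theorem invT_nonneg : 0 ≤ invT J :=
  (ContinuousLinearMap.nonneg_iff_isPositive _).mpr
    (ContinuousLinearMap.isPositive_self_comp_adjoint J)

theorem invSqrtT_mul_self : invSqrtT J * invSqrtT J = invT J :=
  CFC.sqrt_mul_sqrt_self _ (invT_nonneg J)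

theorem star_invSqrtT : star (invSqrtT J) = invSqrtT J :=
  (CFC.sqrt_nonneg (invT J)).isSelfAdjoint.star_eq

theorem inner_invSqrtT_left (f g : H) : inner ℂ (invSqrtT J f) g = inner ℂ f (invSqrtT J g) := by
  have h : ContinuousLinearMap.adjoint (invSqrtT J) = invSqrtT J := star_invSqrtT J
  conv_lhs => rw [← h]
  exact ContinuousLinearMap.adjoint_inner_left _ _ _

theorem invSqrtT_invSqrtT (f : H) :
    invSqrtT J (invSqrtT J f) = J (ContinuousLinearMap.adjoint J f) :=
  congrArg (fun B : BOp H => B f) (invSqrtT_mul_self J)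

/-- Both squared norms are `⟨f, J J† f⟩`. Hence `R f ↦ J† f` is isometric, the origin of the map `V`
below. -/
theorem norm_invSqrtT_apply (f : H) : ‖invSqrtT J f‖ = ‖ContinuousLinearMap.adjoint J f‖ := by
  have h : inner ℂ (invSqrtT J f) (invSqrtT J f) =
      inner ℂ (ContinuousLinearMap.adjoint J f) (ContinuousLinearMap.adjoint J f) := by
    rw [inner_invSqrtT_left, invSqrtT_invSqrtT, ContinuousLinearMap.adjoint_inner_left]
  rw [inner_self_eq_norm_sq_to_K, inner_self_eq_norm_sq_to_K] at h
  have h' : ‖invSqrtT J f‖ ^ 2 = ‖ContinuousLinearMap.adjoint J f‖ ^ 2 := by exact_mod_cast h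
  exact (sq_eq_sq₀ (norm_nonneg _) (norm_nonneg _)).mp h'

variable {J}

theorem invSqrtT_eq_zero (hJ : DenseRange J) {f : H} (hf : invSqrtT J f = 0) : f = 0 := by
  have h0 : ContinuousLinearMap.adjoint J f = 0 := by
    rw [← norm_eq_zero, ← norm_invSqrtT_apply, hf, norm_zero]
  refine hJ.eq_zero_of_inner_left ℂ fun u => ?_
  rw [← ContinuousLinearMap.adjoint_inner_left, h0, inner_zero_left]

theorem denseRange_invSqrtT (hJ : DenseRange J) : DenseRange (invSqrtT J) := by
  have h : (LinearMap.range (invSqrtT J).toLinearMap)ᗮ = ⊥ := by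
    rw [Submodule.eq_bot_iff]
    intro f hf
    refine invSqrtT_eq_zero hJ (ext_inner_left ℂ fun g => ?_)
    rw [← inner_invSqrtT_left, inner_zero_right]
    exact (Submodule.mem_orthogonal _ _).mp hf _ ⟨g, rfl⟩
  have h2 := (Submodule.topologicalClosure_eq_top_iff).mpr h
  have h3 := (Submodule.dense_iff_topologicalClosure_eq_top).mpr h2
  exact h3

/-- `T^{-1/2}` factors through an isometry `H → Q`. -/
theorem exists_isometry_factor (hinj : Function.Injective J) (hJ : DenseRange J) :
    ∃ V : H →L[ℂ] Q, (∀ f, J (V f) = invSqrtT J f) ∧ ∀ f, ‖V f‖ = ‖f‖ := by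
  have key : ∀ f, ∃ u : Q, J u = invSqrtT J f ∧ ‖u‖ = ‖f‖ := by
    intro f
    obtain ⟨g, hg⟩ : ∃ g : ℕ → H, Tendsto (fun k => invSqrtT J (g k)) atTop (𝓝 f) := by
      obtain ⟨x, hx, hlim⟩ := mem_closure_iff_seq_limit.mp (denseRange_invSqrtT hJ f)
      choose g hg using hx
      exact ⟨g, by simpa only [hg] using hlim⟩
    -- As `R g_k → f`, the isometry `R g ↦ J† g` makes `J† g_k` converge in `Q`; its limit is the
    -- value of `V` at `f`.
    have hC : CauchySeq fun k => ContinuousLinearMap.adjoint J (g k) := by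
      rw [Metric.cauchySeq_iff]
      intro ε hε
      obtain ⟨K, hK⟩ := Metric.cauchySeq_iff.mp hg.cauchySeq ε hε
      refine ⟨K, fun m hm l hl => ?_⟩
      have := hK m hm l hl
      rw [dist_eq_norm, ← map_sub, norm_invSqrtT_apply, map_sub] at this
      rwa [dist_eq_norm]
    obtain ⟨u, hu⟩ := cauchySeq_tendsto_of_complete hC
    refine ⟨u, ?_, ?_⟩
    · refine tendsto_nhds_unique ((J.continuous.tendsto u).comp hu) ?_
      refine (((invSqrtT J).continuous.tendsto f).comp hg).congr fun k => ?_
      exact invSqrtT_invSqrtT J (g k)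
    · refine tendsto_nhds_unique hu.norm ?_
      exact hg.norm.congr fun k => norm_invSqrtT_apply J (g k)
  choose v hv hn using key
  -- The values were chosen pointwise; linearity follows from that of `R`, since `J` is injective.
  refine ⟨LinearMap.mkContinuous ⟨⟨v, fun f g => hinj ?_⟩, fun c f => hinj ?_⟩ 1 fun f => ?_,
    hv, hn⟩
  · rw [map_add, hv, hv, hv, map_add]
  · simp only [RingHom.id_apply]
    rw [map_smul, hv, hv, map_smul]
  · rw [one_mul]
    exact (hn f).le

/-- A bounded coercive form on `Q` has a unique sandwich, and it is coercive. -/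
theorem exists_sandwich (hinj : Function.Injective J) (hJ : DenseRange J) {a : Q → Q → ℂ}
    {S : Q →L[ℂ] Q} (ha : ∀ u v, a u v = inner ℂ u (S v)) {δ C : ℝ}
    (hc : ∀ u, ((δ * ‖u‖ ^ 2 - C * ‖J u‖ ^ 2 : ℝ) : ℂ) ≤ a u u) :
    ∃ A : BOp H, (∀ B, IsSandwich J a B ↔ B = A) ∧
      (δ : ℂ) • (1 : BOp H) - (C : ℂ) • (invSqrtT J * invSqrtT J) ≤ A := by
  obtain ⟨V, hV, hn⟩ := exists_isometry_factor hinj hJ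
  have hA : ∀ f g, inner ℂ f ((ContinuousLinearMap.adjoint V ∘L S ∘L V) g) = a (V f) (V g) := by
    intro f g
    rw [ha, ContinuousLinearMap.comp_apply, ContinuousLinearMap.comp_apply,
      ContinuousLinearMap.adjoint_inner_right]
  refine ⟨ContinuousLinearMap.adjoint V ∘L S ∘L V, fun B => ⟨fun hB => ?_, ?_⟩, ?_⟩
  · ext g
    refine ext_inner_left ℂ fun f => ?_
    rw [hA, hB f g (V f) (V g) (hV f) (hV g)]
  · rintro rfl f g u v hu hv
    rw [hA, hinj (hu.trans (hV f).symm), hinj (hv.trans (hV g).symm)]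
  · rw [ContinuousLinearMap.le_def, ContinuousLinearMap.isPositive_iff_complex]
    intro f
    have h1 := hc (V f)
    rw [hn, hV, ← hA f f] at h1
    have h2 : inner ℂ (((ContinuousLinearMap.adjoint V ∘L S ∘L V) - ((δ : ℂ) • (1 : BOp H) -
        (C : ℂ) • (invSqrtT J * invSqrtT J))) f) f =
        starRingEnd ℂ (inner ℂ f ((ContinuousLinearMap.adjoint V ∘L S ∘L V) f) -
          ((δ * ‖f‖ ^ 2 - C * ‖invSqrtT J f‖ ^ 2 : ℝ) : ℂ)) := by
      rw [← inner_conj_symm]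
      congr 1
      have h3 : inner ℂ f ((invSqrtT J) ((invSqrtT J) f)) = ((‖invSqrtT J f‖ ^ 2 : ℝ) : ℂ) := by
        rw [← inner_invSqrtT_left, inner_self_eq_norm_sq_to_K]
        simp
      have h4 : inner ℂ f f = ((‖f‖ ^ 2 : ℝ) : ℂ) := by
        rw [inner_self_eq_norm_sq_to_K]
        simp
      rw [sub_apply, sub_apply, smul_apply, smul_apply, inner_sub_right, inner_sub_right,
        inner_smul_right, inner_smul_right, mul_apply_eq_comp, h3, one_apply_eq_self, h4]
      push_cast
      ring
    have h5 := sub_nonneg.mpr h1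
    rw [h2, Complex.conj_eq_iff_im.mpr (Complex.nonneg_iff.mp h5).2.symm]
    refine ⟨?_, (Complex.nonneg_iff.mp h5).1⟩
    exact Complex.ext rfl (Complex.nonneg_iff.mp h5).2

end SquareRoot

/-! ### Resolvents of forms, written with bounded operators. -/

section Resolvent

variable {H : Type*} [NormedAddCommGroup H] [InnerProductSpace ℂ H] [CompleteSpace H]

/-- For `G = R h R` with `h ≥ 0` and `R = T^{-1/2}`, this is the resolvent `(h + 1)⁻¹`. -/
def formResolvent (R G : BOp H) : BOp H := R * Ring.inverse (G + R * R) * R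

variable {R G : BOp H}

theorem star_inverse_eq (hR : star R = R) (hG : 0 ≤ G) (hM : IsUnit (G + R * R)) :
    star (Ring.inverse (G + R * R)) = Ring.inverse (G + R * R) := by
  set M := G + R * R with hMdef
  have hMs : star M = M := by
    rw [hMdef, star_add, star_mul, hR, hG.isSelfAdjoint.star_eq]
  have h1 : star (Ring.inverse M) * M = 1 := by
    have := congrArg star (Ring.mul_inverse_cancel M hM)
    rwa [star_mul, hMs, star_one] at this
  calc star (Ring.inverse M) = star (Ring.inverse M) * (M * Ring.inverse M) := by
        rw [Ring.mul_inverse_cancel M hM, mul_one]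
    _ = Ring.inverse M := by rw [← mul_assoc, h1, one_mul]

/-- The identity `K - K² = K h K`, in which the unbounded `h` appears only through `G = R h R`. -/
theorem formResolvent_sub_mul_self (hM : IsUnit (G + R * R)) :
    formResolvent R G - formResolvent R G * formResolvent R G =
      R * Ring.inverse (G + R * R) * G * (Ring.inverse (G + R * R) * R) := by
  set M := G + R * R with hMdef
  have hG : G = M - R * R := by rw [hMdef]; abel
  have h1 := Ring.mul_inverse_cancel M hM
  rw [formResolvent, ← hMdef]
  set N := Ring.inverse M
  have h2 : R * N * R = R * N * M * N * R := by
    rw [mul_assoc (R * N) M N, h1, mul_one]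
  conv_rhs => rw [hG]
  rw [mul_sub, sub_mul]
  congr 1

theorem star_formResolvent (hR : star R = R) (hG : 0 ≤ G) (hM : IsUnit (G + R * R)) :
    star (formResolvent R G) = formResolvent R G := by
  rw [formResolvent, star_mul, star_mul, hR, star_inverse_eq hR hG hM, mul_assoc]

theorem formResolvent_sub_mul_self_nonneg (hR : star R = R) (hG : 0 ≤ G)
    (hM : IsUnit (G + R * R)) :
    0 ≤ formResolvent R G - formResolvent R G * formResolvent R G := by
  rw [formResolvent_sub_mul_self hM]
  have := star_left_conjugate_nonneg hG (Ring.inverse (G + R * R) * R)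
  rwa [star_mul, hR, star_inverse_eq hR hG hM] at this

/-- `K = (K - K²) + K²`, a sum of positive operators. -/
theorem formResolvent_nonneg (hR : star R = R) (hG : 0 ≤ G) (hM : IsUnit (G + R * R)) :
    0 ≤ formResolvent R G := by
  have h1 := formResolvent_sub_mul_self_nonneg hR hG hM
  have h2 := star_mul_self_nonneg (formResolvent R G)
  rw [star_formResolvent hR hG hM] at h2
  have := add_nonneg h1 h2
  rwa [sub_add_cancel] at this

/-- `1 - K = (K - K²) + (1 - K)²`, a sum of positive operators. -/
theorem formResolvent_le_one (hR : star R = R) (hG : 0 ≤ G) (hM : IsUnit (G + R * R)) :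
    formResolvent R G ≤ 1 := by
  have h1 := formResolvent_sub_mul_self_nonneg hR hG hM
  have h2 := star_mul_self_nonneg (1 - formResolvent R G)
  rw [star_sub, star_one, star_formResolvent hR hG hM] at h2
  have h3 := add_nonneg h1 h2
  rw [← sub_nonneg]
  convert h3 using 1
  noncomm_ring

theorem norm_formResolvent_le_one (hR : star R = R) (hG : 0 ≤ G) (hM : IsUnit (G + R * R)) :
    ‖formResolvent R G‖ ≤ 1 :=
  (CStarAlgebra.norm_le_one_iff_of_nonneg _ (formResolvent_nonneg hR hG hM)).mpr
    (formResolvent_le_one hR hG hM)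

/-- A positive functional vanishing on `R h R` takes the same values on `R (h + 1)⁻¹ R` and on
`R²`. -/
theorem map_mul_formResolvent_mul (hG : 0 ≤ G) (hM : IsUnit (G + R * R))
    {ρ : StrongDual ℂ (BOp H)} (hρ : ∀ B : BOp H, 0 ≤ B → 0 ≤ ρ B) (h0 : ρ G = 0) :
    ρ (R * formResolvent R G * R) = ρ (R * R) := by
  set M := G + R * R with hMdef
  have hRR : R * R = M - G := by rw [hMdef]; abel
  have h1 := Ring.mul_inverse_cancel M hM
  have h2 := Ring.inverse_mul_cancel M hM
  -- Substitute `R² = M - G` on both sides of `M⁻¹`. The two extra terms contain `G`, on which `ρ`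
  -- vanishes, also after multiplication by a bounded operator.
  have h3 : R * formResolvent R G * R = R * R - G + G * (Ring.inverse M * G) := by
    rw [formResolvent, ← hMdef]
    set N := Ring.inverse M
    calc R * (R * N * R) * R = (R * R) * N * (R * R) := by noncomm_ring
      _ = M * N * M - M * N * G - G * (N * M) + G * (N * G) := by rw [hRR]; noncomm_ring
      _ = R * R - G + G * (N * G) := by
        rw [h1, h2, hRR]; noncomm_ring
  rw [h3, map_add, map_sub, h0, (map_mul_eq_zero_of_nonneg hρ hG h0 _).1]
  simp

/-- A state that is maximal on `(h + 1)⁻¹` is in the domain of `T`, with vanishing energy of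
`h`. -/
theorem exists_lift_of_map_formResolvent (hR : star R = R) (hG : 0 ≤ G)
    (hM : IsUnit (G + R * R)) {ρ : StrongDual ℂ (BOp H)} (hρ : ρ ∈ stateFace (formResolvent R G)) :
    ∃ ρT ∈ genPositive H, (∀ B : BOp H, ρT (R * B * R) = ρ B) ∧ ρT G = 0 := by
  obtain ⟨hst, h1⟩ := hρ
  obtain ⟨hpos, hone⟩ := mem_genStates_iff.mp hst
  have hcomp := map_compress_eq hpos (formResolvent_le_one hR hG hM) (h1.trans hone.symm)
  have hN := star_inverse_eq hR hG hM
  -- Formally `M⁻¹ R = T^{1/2} K`, so this is `ρ` compressed by `K` and lifted. Its value at `R B R`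
  -- is `ρ (K B K) = ρ B`, and its value at `G` is `ρ (K - K²)`.
  refine ⟨conjFunctional ρ (Ring.inverse (G + R * R) * R),
    mem_genPositive_iff.mpr (conjFunctional_nonneg hpos _), fun B => ?_, ?_⟩
  · rw [conjFunctional_apply, star_mul, hR, hN, ← hcomp B, formResolvent]
    congr 1
  · rw [conjFunctional_apply, star_mul, hR, hN, ← formResolvent_sub_mul_self hM, map_sub, h1]
    have := hcomp 1
    rw [mul_one, hone] at this
    rw [this, sub_self]

/-- Coercivity controls `G` only up to a multiple of `R²` that may exceed `1`. Using just a fraction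
`t` of it, and positivity of `G` for the rest, bounds `G + R²` below by `t δ > 0`. -/
theorem isUnit_add_mul_self (hR : star R = R) (hG : 0 ≤ G) {δ C : ℝ} (hδ : 0 < δ)
    (hc : (δ : ℂ) • (1 : BOp H) - (C : ℂ) • (R * R) ≤ G) : IsUnit (G + R * R) := by
  set t : ℝ := 1 / (1 + |C|) with ht
  have ht0 : 0 < t := by positivity
  have ht1 : t ≤ 1 := by
    rw [ht, div_le_one (by positivity)]
    linarith [abs_nonneg C]
  have htC : t * C ≤ 1 := by
    rw [ht, div_mul_eq_mul_div, one_mul, div_le_one (by positivity)]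
    linarith [le_abs_self C]
  have hRR : 0 ≤ R * R := by
    have := star_mul_self_nonneg R
    rwa [hR] at this
  have ht0' : (0 : ℂ) ≤ (t : ℂ) := by exact_mod_cast ht0.le
  have ht1' : (0 : ℂ) ≤ ((1 - t : ℝ) : ℂ) := by exact_mod_cast sub_nonneg.mpr ht1
  have htC' : (0 : ℂ) ≤ ((1 - t * C : ℝ) : ℂ) := by exact_mod_cast sub_nonneg.mpr htC
  have hle : ((t * δ : ℝ) : ℂ) • (1 : BOp H) ≤ G + R * R := by
    have h1 := smul_nonneg ht0' (sub_nonneg.mpr hc)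
    have h2 := smul_nonneg ht1' hG
    have h3 := smul_nonneg htC' hRR
    rw [← sub_nonneg]
    -- `G + R² - tδ = t (G - δ + C R²) + (1 - t) G + (1 - tC) R²`.
    convert add_nonneg (add_nonneg h1 h2) h3 using 1
    push_cast
    module
  refine CStarAlgebra.isUnit_of_le _ hle ?_
  have hp : (0 : ℂ) ≤ ((t * δ : ℝ) : ℂ) := by exact_mod_cast (mul_pos ht0 hδ).le
  refine IsStrictlyPositive.iff_of_unital.mpr ⟨smul_nonneg hp zero_le_one, ?_⟩
  have hne : ((t * δ : ℝ) : ℂ) ≠ 0 := by exact_mod_cast (mul_pos ht0 hδ).ne'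
  have := (isUnit_one : IsUnit (1 : BOp H)).smul (Units.mk0 _ hne)
  exact this

/-- Inversion is continuous at units, so the inverses of simple approximations converge, even if
some approximants are not units and are sent to the default value. -/
theorem aestronglyMeasurable_inverse {X 𝕄 : Type*} [MeasurableSpace X] {μ : Measure X}
    [NormedRing 𝕄] [CompleteSpace 𝕄] {M : X → 𝕄} (hM : AEStronglyMeasurable M μ)
    (hu : ∀ z, IsUnit (M z)) : AEStronglyMeasurable (fun z => Ring.inverse (M z)) μ := by
  refine aestronglyMeasurable_of_tendsto_ae (u := atTop)
    (f := fun k z => ((hM.stronglyMeasurable_mk.approx k).map Ring.inverse) z)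
    (fun k => (SimpleFunc.stronglyMeasurable _).aestronglyMeasurable) ?_
  filter_upwards [hM.ae_eq_mk] with z hz
  obtain ⟨m, hm⟩ := hu z
  have h1 := NormedRing.inverse_continuousAt m
  rw [hm, hz] at h1
  rw [hz]
  exact h1.tendsto.comp (hM.stronglyMeasurable_mk.tendsto_approx z)

end Resolvent

/-! ### Equality of the infima, and minimizers, for coercive forms. -/

section Equivalence

variable {H : Type*} [NormedAddCommGroup H] [InnerProductSpace ℂ H] [CompleteSpace H]
  {Q : Type*} [NormedAddCommGroup Q] [InnerProductSpace ℂ Q] [CompleteSpace Q]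
  {X : Type*} [MeasurableSpace X] {J : Q →L[ℂ] H} {a : X → Q → Q → ℂ} {A : X → BOp H}

/-- `A z = T^{-1/2} ℋ_z T^{-1/2}` is the only sandwich of the form of `ℋ_z`, and the forms are
coercive: `ℋ_z ≥ δ T - C` with `δ > 0`. -/
structure IsCoerciveSandwich (J : Q →L[ℂ] H) (a : X → Q → Q → ℂ) (A : X → BOp H) : Prop where
  isSandwich_iff : ∀ z B, IsSandwich J (a z) B ↔ B = A z
  coercive : ∀ z, ∃ δ : ℝ, 0 < δ ∧ ∃ C : ℝ,
    (δ : ℂ) • (1 : BOp H) - (C : ℂ) • (invSqrtT J * invSqrtT J) ≤ A z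

/-- `T^{-1/2} (ℋ_z - E) T^{-1/2}`. -/
def shifted (J : Q →L[ℂ] H) (A : X → BOp H) (E : ℝ) (z : X) : BOp H :=
  A z - (E : ℂ) • (invSqrtT J * invSqrtT J)

/-- `(ℋ_z - E + 1)⁻¹`. -/
def shiftedResolvent (J : Q →L[ℂ] H) (A : X → BOp H) (E : ℝ) (z : X) : BOp H :=
  formResolvent (invSqrtT J) (shifted J A E z)

namespace IsCoerciveSandwich

theorem isSelfAdjoint (hA : IsCoerciveSandwich J a A) (z : X) : IsSelfAdjoint (A z) := by
  obtain ⟨δ, -, C, h⟩ := hA.coercive z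
  have h1 := (sub_nonneg.mpr h).isSelfAdjoint
  have h2 : IsSelfAdjoint ((δ : ℂ) • (1 : BOp H) - (C : ℂ) • (invSqrtT J * invSqrtT J)) := by
    rw [isSelfAdjoint_iff, star_sub, star_smul, star_smul, star_mul, star_invSqrtT]
    simp
  simpa using h1.add h2

theorem isUnit (hA : IsCoerciveSandwich J a A) {E : ℝ} {z : X} (hG : 0 ≤ shifted J A E z) :
    IsUnit (shifted J A E z + invSqrtT J * invSqrtT J) := by
  obtain ⟨δ, hδ, C, h⟩ := hA.coercive z
  -- Subtracting `E R²` from `A z` raises the constant in the lower bound by `E`.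
  refine isUnit_add_mul_self (star_invSqrtT J) hG hδ (C := C + E) ?_
  rw [shifted, ← sub_nonneg]
  convert sub_nonneg.mpr h using 1
  push_cast
  module

/-- Vector states show that a lower bound for the energy of pure states is a lower bound for the
operators. -/
theorem shifted_nonneg (hA : IsCoerciveSandwich J a A) (hJ : DenseRange J) {c : ℝ}
    (hc : (c : EReal) ≤ gqcInf J a (genPureStates H)) (z : X) : 0 ≤ shifted J A c z := by
  have hreal : ∀ f, inner ℂ f (A z f) = ((inner ℂ f (A z f)).re : ℂ) := by
    intro f
    have h1 : ContinuousLinearMap.adjoint (A z) = A z := hA.isSelfAdjoint z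
    have h2 : starRingEnd ℂ (inner ℂ f (A z f)) = inner ℂ f (A z f) := by
      rw [inner_conj_symm]
      conv_lhs => rw [← h1]
      exact ContinuousLinearMap.adjoint_inner_left _ _ _
    exact (Complex.conj_eq_iff_re.mp h2).symm
  have hunit : ∀ f, ‖invSqrtT J f‖ = 1 → c ≤ (inner ℂ f (A z f)).re := by
    intro f hf
    have h1 : gqcInf J a (genPureStates H) ≤ (((inner ℂ f (A z f)).re : ℝ) : EReal) := by
      -- The vector state of `R f` is lifted by the vector functional of `f`.
      refine sInf_le ⟨vecFunctional (invSqrtT J f) (invSqrtT J f),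
        vecFunctional_mem_genPureStates hf, z, _,
        ⟨vecFunctional f f, mem_genPositive_iff.mpr (vecFunctional_nonneg f), fun B => ?_,
          A z, (hA.isSandwich_iff z _).mpr rfl, hreal f⟩, rfl⟩
      rw [vecFunctional_apply, vecFunctional_apply, inner_invSqrtT_left]
      rfl
    exact_mod_cast hc.trans h1
  have hall : ∀ f, c * ‖invSqrtT J f‖ ^ 2 ≤ (inner ℂ f (A z f)).re := by
    intro f
    by_cases h0 : invSqrtT J f = 0
    · rw [invSqrtT_eq_zero hJ h0]
      simp
    · have hn : ‖invSqrtT J f‖ ≠ 0 := norm_ne_zero_iff.mpr h0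
      have h1 := hunit (((‖invSqrtT J f‖⁻¹ : ℝ) : ℂ) • f) (by
        rw [map_smul, norm_smul, Complex.norm_real, norm_inv, norm_norm, inv_mul_cancel₀ hn])
      rw [map_smul, inner_smul_left, inner_smul_right, Complex.conj_ofReal, ← mul_assoc,
        ← Complex.ofReal_mul, Complex.re_ofReal_mul] at h1
      have h2 := mul_le_mul_of_nonneg_right h1 (sq_nonneg ‖invSqrtT J f‖)
      refine h2.trans (le_of_eq ?_)
      field_simp
  rw [ContinuousLinearMap.nonneg_iff_isPositive, ContinuousLinearMap.isPositive_iff_complex]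
  intro f
  have h1 : inner ℂ (shifted J A c z f) f =
      (((inner ℂ f (A z f)).re - c * ‖invSqrtT J f‖ ^ 2 : ℝ) : ℂ) := by
    have h3 : inner ℂ f ((invSqrtT J) ((invSqrtT J) f)) = ((‖invSqrtT J f‖ ^ 2 : ℝ) : ℂ) := by
      rw [← inner_invSqrtT_left, inner_self_eq_norm_sq_to_K]
      simp
    rw [← inner_conj_symm, shifted, sub_apply, smul_apply, inner_sub_right, inner_smul_right,
      mul_apply_eq_comp, h3, ← Complex.ofReal_mul, map_sub, Complex.conj_ofReal, hreal f,
      Complex.conj_ofReal, Complex.ofReal_re, ← Complex.ofReal_sub]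
  rw [h1]
  exact ⟨rfl, sub_nonneg.mpr (hall f)⟩

/-- Dirac measures have the energy of their value. -/
theorem isGsvmEnergy_dirac [MeasurableSingletonClass X] (hA : IsCoerciveSandwich J a A)
    {ρ : StrongDual ℂ (BOp H)} (hρ : ρ ∈ genStates H) {z : X} {e : ℝ}
    (he : IsGqcEnergy J a ρ z e) :
    ‖(GenMeasure.dirac z hρ.1).vm Set.univ‖ = 1 ∧
      IsGsvmEnergy J a (GenMeasure.dirac z hρ.1) e := by
  obtain ⟨ρT, hρT, hlift, B, hB, hBe⟩ := he
  obtain rfl : B = A z := (hA.isSandwich_iff z _).mp hB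
  constructor
  · change ‖VectorMeasure.dirac z ρ Set.univ‖ = 1
    rw [VectorMeasure.dirac_apply_of_mem MeasurableSet.univ (Set.mem_univ z), hρ.2]
  · refine ⟨GenMeasure.dirac z hρT, fun S hS B => ?_, A,
      fun y => (hA.isSandwich_iff y _).mpr rfl, GenMeasure.integrable_dirac z hρT A, ?_⟩
    · change VectorMeasure.dirac z ρT S _ = VectorMeasure.dirac z ρ S _
      by_cases hz : z ∈ S
      · rw [VectorMeasure.dirac_apply_of_mem hS hz, VectorMeasure.dirac_apply_of_mem hS hz]
        exact hlift B
      · rw [VectorMeasure.dirac_apply_of_notMem hz, VectorMeasure.dirac_apply_of_notMem hz]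
        rfl
    · rw [GenMeasure.integral_dirac, hBe]

/-- The energy of a measure in terms of a weak-* density of its lift. -/
theorem energy_eq {n nT : GenMeasure X H} (hL : IsLift J n nT) (hn : ‖n.vm Set.univ‖ = 1)
    (hAi : Integrable A nT.normMeasure) {ρT : X → StrongDual ℂ (BOp H)}
    (hT : IsWeakDensity nT ρT) (c : ℝ) :
    Integrable (fun z => (ρT z (shifted J A c z)).re) nT.normMeasure ∧
      (nT.integral A).re = c + ∫ z, (ρT z (shifted J A c z)).re ∂nT.normMeasure := by
  have hi1 := hT.integrable hAi
  have hi2 := (hT.2 (invSqrtT J * invSqrtT J)).1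
  have hint : Integrable (fun z => ρT z (shifted J A c z)) nT.normMeasure := by
    simp only [shifted, map_sub, map_smul, smul_eq_mul]
    exact hi1.sub (hi2.const_mul _)
  have h1 : ∫ z, ρT z (invSqrtT J * invSqrtT J) ∂nT.normMeasure = 1 := by
    have h2 := (hT.2 (invSqrtT J * invSqrtT J)).2 Set.univ MeasurableSet.univ
    have h3 := hL Set.univ MeasurableSet.univ 1
    rw [mul_one] at h3
    rw [setIntegral_univ] at h2
    rw [← h2, h3, ← norm_eq_of_positive (n.mem_genPositive _ MeasurableSet.univ).2, hn]
    simp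
  have h4 : nT.integral A = (c : ℂ) + ∫ z, ρT z (shifted J A c z) ∂nT.normMeasure := by
    simp only [shifted, map_sub, map_smul, smul_eq_mul]
    rw [integral_sub hi1 (hi2.const_mul _), integral_const_mul, h1, mul_one, hT.integral_eq hAi]
    ring
  refine ⟨hint.re, ?_⟩
  rw [h4, Complex.add_re, Complex.ofReal_re]
  congr 1
  exact (Complex.reCLM.integral_comp_comm hint).symm

variable [MeasurableSpace.CountablyGenerated X]

/-- By `energy_eq` the energy is `c` plus the integral of a positive functional at a positive
operator. -/
theorem le_gsvmInf (hA : IsCoerciveSandwich J a A) {c : ℝ} (hc : ∀ z, 0 ≤ shifted J A c z) :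
    (c : EReal) ≤ gsvmInf J a := by
  refine le_sInf ?_
  rintro _ ⟨n, hn, e, ⟨nT, hL, A', hA', hi, he⟩, rfl⟩
  obtain rfl : A' = A := funext fun z => (hA.isSandwich_iff z _).mp (hA' z)
  obtain ⟨ρT, hT⟩ := nT.exists_isWeakDensity
  have h := (energy_eq hL hn hi hT c).2
  rw [he, Complex.ofReal_re] at h
  have h0 : 0 ≤ ∫ z, (ρT z (shifted J A' c z)).re ∂nT.normMeasure := by
    refine integral_nonneg_of_ae ?_
    filter_upwards [hT.1] with z hz
    exact (Complex.nonneg_iff.mp ((mem_genStates_iff.mp hz).1 _ (hc z))).1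
  exact_mod_cast (by linarith : c ≤ e)

variable [MeasurableSingletonClass X]

/-- The three variational problems have the same infimum. -/
theorem inf_eq (hA : IsCoerciveSandwich J a A) (hJ : DenseRange J) :
    gqcInf J a (genStates H) = gsvmInf J a ∧ gqcInf J a (genPureStates H) = gsvmInf J a := by
  have h1 : gsvmInf J a ≤ gqcInf J a (genStates H) := by
    refine le_sInf ?_
    rintro _ ⟨ρ, hρ, z, e, he, rfl⟩
    obtain ⟨h, h'⟩ := hA.isGsvmEnergy_dirac hρ he
    exact sInf_le ⟨_, h, e, h', rfl⟩
  have h2 : gqcInf J a (genStates H) ≤ gqcInf J a (genPureStates H) := by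
    refine sInf_le_sInf ?_
    rintro _ ⟨ρ, hρ, z, e, he, rfl⟩
    exact ⟨ρ, extremePoints_subset hρ, z, e, he, rfl⟩
  have h3 : gqcInf J a (genPureStates H) ≤ gsvmInf J a := by
    by_contra h
    -- A real number in the gap is needed to form `shifted`; the infima themselves are extended
    -- reals.
    obtain ⟨c, hc1, hc2⟩ := EReal.lt_iff_exists_real_btwn.mp (not_le.mp h)
    exact absurd (hA.le_gsvmInf (hA.shifted_nonneg hJ hc2.le)) (not_le.mpr hc1)
  exact ⟨le_antisymm (h2.trans h3) h1, le_antisymm h3 (h1.trans h2)⟩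

/-- The minimizers are the states with `ρ[(ℋ_z - E + 1)⁻¹] = 1`. -/
theorem isGqcMinimizer_iff (hA : IsCoerciveSandwich J a A) (hJ : DenseRange J) {E : ℝ}
    (hE : (E : EReal) = gsvmInf J a) {𝒮 : Set (StrongDual ℂ (BOp H))} (h𝒮 : 𝒮 ⊆ genStates H)
    (hinf : gqcInf J a 𝒮 = gsvmInf J a) {ρ : StrongDual ℂ (BOp H)} {z : X} :
    IsGqcMinimizer J a 𝒮 ρ z ↔ ρ ∈ 𝒮 ∧ ρ (shiftedResolvent J A E z) = 1 := by
  have hG := hA.shifted_nonneg hJ (hE.trans (hA.inf_eq hJ).2.symm).le z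
  have hM := hA.isUnit hG
  refine and_congr_right fun hρ => ?_
  obtain ⟨hpos, hone⟩ := mem_genStates_iff.mp (h𝒮 hρ)
  constructor
  · rintro ⟨e, ⟨ρT, hρT, hlift, B, hB, hBe⟩, he⟩
    obtain rfl : B = A z := (hA.isSandwich_iff z _).mp hB
    obtain rfl : e = E := by
      rw [hinf, ← hE] at he
      exact_mod_cast he
    have hRR : ρT (invSqrtT J * invSqrtT J) = 1 := by
      have := hlift 1
      rwa [mul_one, hone] at this
    have h0 : ρT (shifted J A e z) = 0 := by
      rw [shifted, map_sub, map_smul, hRR, hBe]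
      simp
    rw [← hlift, shiftedResolvent, map_mul_formResolvent_mul hG hM hρT.2 h0, hRR]
  · intro h1
    obtain ⟨ρT, hρT, hlift, h0⟩ :=
      exists_lift_of_map_formResolvent (star_invSqrtT J) hG hM ⟨h𝒮 hρ, h1⟩
    refine ⟨E, ⟨ρT, hρT, hlift, A z, (hA.isSandwich_iff z _).mpr rfl, ?_⟩, hE.trans hinf.symm⟩
    have hRR : ρT (invSqrtT J * invSqrtT J) = 1 := by
      have := hlift 1
      rwa [mul_one, hone] at this
    rw [shifted, map_sub, map_smul, hRR, sub_eq_zero] at h0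
    rw [h0]
    simp

/-- A weak-* density of a minimizing measure is maximal on the resolvents. -/
theorem ae_map_shiftedResolvent (hA : IsCoerciveSandwich J a A) (hJ : DenseRange J)
    {n : GenMeasure X H} (hn : ‖n.vm Set.univ‖ = 1) {E : ℝ} (hE : (E : EReal) = gsvmInf J a)
    (hmin : IsGsvmEnergy J a n E) {ρ : X → StrongDual ℂ (BOp H)} (hρ : IsWeakDensity n ρ) :
    ∀ᵐ z ∂n.normMeasure, ρ z (shiftedResolvent J A E z) = 1 := by
  obtain ⟨nT, hL, A', hA', hi, he⟩ := hmin
  obtain rfl : A' = A := funext fun z => (hA.isSandwich_iff z _).mp (hA' z)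
  have hG := hA.shifted_nonneg hJ (hE.trans (hA.inf_eq hJ).2.symm).le
  have hM := fun z => hA.isUnit (hG z)
  have hR := star_invSqrtT J
  obtain ⟨ρT, hT⟩ := nT.exists_isWeakDensity
  have hzero : ∀ᵐ z ∂nT.normMeasure, ρT z (shifted J A' E z) = 0 := by
    obtain ⟨hint, h⟩ := energy_eq hL hn hi hT E
    rw [he, Complex.ofReal_re, left_eq_add] at h
    have hnn : 0 ≤ᵐ[nT.normMeasure] fun z => (ρT z (shifted J A' E z)).re := by
      filter_upwards [hT.1] with z hz
      exact (Complex.nonneg_iff.mp ((mem_genStates_iff.mp hz).1 _ (hG z))).1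
    filter_upwards [(integral_eq_zero_iff_of_nonneg_ae hnn hint).mp h, hT.1] with z h1 h2
    exact Complex.ext h1 (Complex.nonneg_iff.mp ((mem_genStates_iff.mp h2).1 _ (hG z))).2.symm
  -- Norm measurability of the resolvents comes from that of `A` through inversion; they are bounded
  -- by `1` on a finite measure.
  have hKi : Integrable (shiftedResolvent J A' E) nT.normMeasure := by
    refine Integrable.of_bound ?_ 1
      (Eventually.of_forall fun z => norm_formResolvent_le_one hR (hG z) (hM z))
    have h1 : AEStronglyMeasurable
        (fun z => shifted J A' E z + invSqrtT J * invSqrtT J) nT.normMeasure :=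
      (hi.aestronglyMeasurable.sub aestronglyMeasurable_const).add aestronglyMeasurable_const
    exact ((aestronglyMeasurable_inverse h1 hM).const_mul _).mul_const _
  have hint1 : ∫ z, ρ z (shiftedResolvent J A' E z) ∂n.normMeasure = 1 := by
    rw [hL.integral_eq hρ hT hKi]
    have h2 : ∫ z, ρT z (invSqrtT J * shiftedResolvent J A' E z * invSqrtT J) ∂nT.normMeasure =
        ∫ z, ρT z (invSqrtT J * invSqrtT J) ∂nT.normMeasure := by
      refine integral_congr_ae ?_
      filter_upwards [hzero, hT.1] with z h1 h2
      exact map_mul_formResolvent_mul (hG z) (hM z) (mem_genStates_iff.mp h2).1 h1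
    have h3 := (hT.2 (invSqrtT J * invSqrtT J)).2 Set.univ MeasurableSet.univ
    have h4 := hL Set.univ MeasurableSet.univ 1
    rw [mul_one] at h4
    rw [setIntegral_univ] at h3
    rw [h2, ← h3, h4, ← norm_eq_of_positive (n.mem_genPositive _ MeasurableSet.univ).2, hn]
    simp
  have hKi' := hρ.integrable (hL.integrable hKi)
  have hint2 : Integrable (fun z => 1 - (ρ z (shiftedResolvent J A' E z)).re) n.normMeasure :=
    (integrable_const _).sub hKi'.re
  have hnn : 0 ≤ᵐ[n.normMeasure] fun z => 1 - (ρ z (shiftedResolvent J A' E z)).re := by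
    filter_upwards [hρ.1] with z hz
    have h1 := norm_le_of_mem_genStates hz (shiftedResolvent J A' E z)
    have h2 : ‖shiftedResolvent J A' E z‖ ≤ 1 := norm_formResolvent_le_one hR (hG z) (hM z)
    have h3 := Complex.re_le_norm (ρ z (shiftedResolvent J A' E z))
    simp only [Pi.zero_apply]
    linarith
  have h0 : ∫ z, (1 - (ρ z (shiftedResolvent J A' E z)).re) ∂n.normMeasure = 0 := by
    have h1 : ∫ z, (ρ z (shiftedResolvent J A' E z)).re ∂n.normMeasure = 1 := by
      have := Complex.reCLM.integral_comp_comm hKi'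
      rw [hint1] at this
      simpa using this
    have h2 : Integrable (fun z => (ρ z (shiftedResolvent J A' E z)).re) n.normMeasure := hKi'.re
    rw [integral_sub (integrable_const _) h2, h1]
    simp [n.normMeasure_real MeasurableSet.univ, hn]
  filter_upwards [(integral_eq_zero_iff_of_nonneg_ae hnn hint2).mp h0, hρ.1] with z h1 h2
  have h3 := (mem_genStates_iff.mp h2).1 _ (formResolvent_nonneg hR (hG z) (hM z))
  refine Complex.ext ?_ (Complex.nonneg_iff.mp h3).2.symm
  simp only [Pi.zero_apply] at h1
  rw [Complex.one_re]
  linarith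

theorem minimizerEquivalence (hA : IsCoerciveSandwich J a A) (hJ : DenseRange J) :
    MinimizerEquivalence J a := by
  obtain ⟨hgen, hpure⟩ := hA.inf_eq hJ
  have hsub : genPureStates H ⊆ genStates H := extremePoints_subset
  have hK : ∀ {E : ℝ}, (E : EReal) = gsvmInf J a → ∀ z, shiftedResolvent J A E z ≤ 1 := by
    intro E hE z
    have hG := hA.shifted_nonneg hJ (hE.trans hpure.symm).le z
    exact formResolvent_le_one (star_invSqrtT J) hG (hA.isUnit hG)
  have hconc : ∀ n : GenMeasure X H, IsGsvmMinimizer J a n → IsConcentrated J a n := by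
    rintro n ⟨hn, E, hmin, hE⟩
    refine ⟨n.exists_isWeakDensity, fun ρ hρ => ?_⟩
    filter_upwards [hA.ae_map_shiftedResolvent hJ hn hE hmin hρ, hρ.1] with z h1 h2
    refine ⟨(hA.isGqcMinimizer_iff hJ hE subset_rfl hgen).mpr ⟨h2, h1⟩, ?_⟩
    -- The pure minimizers at `z` become the pure states in the face of the resolvent.
    simp only [hA.isGqcMinimizer_iff hJ hE hsub hpure]
    exact mem_closure_convexHull_pure (hK hE z) ⟨h2, h1⟩
  have hto : (∃ ρ z, IsGqcMinimizer J a (genStates H) ρ z) →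
      ∃ n : GenMeasure X H, IsGsvmMinimizer J a n := by
    rintro ⟨ρ, z, hρ, e, he, hinf⟩
    obtain ⟨h1, h2⟩ := hA.isGsvmEnergy_dirac hρ he
    exact ⟨_, h1, e, h2, hinf.trans hgen⟩
  have hfrom : (∃ n : GenMeasure X H, IsGsvmMinimizer J a n) →
      ∃ ρ z, IsGqcMinimizer J a (genStates H) ρ z := by
    rintro ⟨n, hn⟩
    obtain ⟨⟨ρ, hρ⟩, h⟩ := hconc n hn
    -- Total mass one lets a point be picked from a property that holds almost everywhere.
    have hne : n.normMeasure ≠ 0 := by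
      intro h0
      have := n.normMeasure_real MeasurableSet.univ
      rw [hn.1, h0] at this
      simp at this
    have := (ae_neBot.mpr hne)
    obtain ⟨z, hz, -⟩ := (h ρ hρ).exists
    exact ⟨ρ z, z, hz⟩
  refine ⟨⟨hto, hfrom⟩, ⟨?_, fun hn => ?_⟩, hconc⟩
  · rintro ⟨ρ, z, hρ, e, he, hinf⟩
    exact hto ⟨ρ, z, hsub hρ, e, he, hinf.trans (hpure.trans hgen.symm)⟩
  · obtain ⟨ρ, z, hmin⟩ := hfrom hn
    obtain ⟨hρ, E, hE, hinf⟩ := hmin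
    have hE' := hinf.trans hgen
    have h1 := (hA.isGqcMinimizer_iff hJ hE' subset_rfl hgen).mp ⟨hρ, E, hE, hinf⟩
    obtain ⟨σ, hσ, hσ1⟩ := exists_pure_of_mem_stateFace (hK hE' z) h1
    exact ⟨σ, z, (hA.isGqcMinimizer_iff hJ hE' hsub hpure).mpr ⟨hσ, hσ1⟩⟩

end IsCoerciveSandwich

/-- The minimizer equivalence for bounded, coercive forms. -/
theorem minimizerEquivalence_of_coercive [MeasurableSpace.CountablyGenerated X]
    [MeasurableSingletonClass X] (hinj : Function.Injective J) (hJ : DenseRange J)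
    (hbdd : ∀ z, ∃ S : Q →L[ℂ] Q, ∀ u v, a z u v = inner ℂ u (S v))
    (hcoer : ∀ z, ∃ δ : ℝ, 0 < δ ∧ ∃ C : ℝ,
      ∀ u, ((δ * ‖u‖ ^ 2 - C * ‖J u‖ ^ 2 : ℝ) : ℂ) ≤ a z u u) :
    MinimizerEquivalence J a := by
  have h : ∀ z, ∃ A : BOp H, (∀ B, IsSandwich J (a z) B ↔ B = A) ∧ ∃ δ : ℝ, 0 < δ ∧ ∃ C : ℝ,
      (δ : ℂ) • (1 : BOp H) - (C : ℂ) • (invSqrtT J * invSqrtT J) ≤ A := by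
    intro z
    obtain ⟨S, hS⟩ := hbdd z
    obtain ⟨δ, hδ, C, hC⟩ := hcoer z
    obtain ⟨A, h1, h2⟩ := exists_sandwich hinj hJ hS hC
    exact ⟨A, h1, δ, hδ, C, h2⟩
  choose A h1 h2 using h
  exact IsCoerciveSandwich.minimizerEquivalence ⟨h1, h2⟩ hJ

end Equivalence

/-! ### The form domain of `T` and first-order perturbations. -/

section FormDomain

variable {N d : ℕ} {κ : Fin N → ℝ} {W : Cfg N d → ℝ}

theorem locallyIntegrable_coeFn (f : L2 N d) : LocallyIntegrable f volume :=
  (Lp.memLp f).locallyIntegrable one_le_two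

theorem eq_zero_of_forall_integral_eq_zero {f : L2 N d}
    (h : ∀ φ : Cfg N d → ℝ, ContDiff ℝ ((⊤ : ℕ∞) : WithTop ℕ∞) φ → HasCompactSupport φ →
      ∫ x, (φ x : ℂ) * f x = 0) : f = 0 := by
  have h1 := ae_eq_zero_of_integral_contDiff_smul_eq_zero (locallyIntegrable_coeFn f)
    fun φ hφ hc => by simpa only [Complex.real_smul] using h φ hφ hc
  refine Lp.ext ?_
  filter_upwards [h1, Lp.coeFn_zero ℂ 2 (volume : Measure (Cfg N d))] with x h2 h3
  rw [h2, h3, Pi.zero_apply]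

/-- The wave function determines the other components: `√𝒲 ψ` by multiplication, the gradient by
uniqueness of weak derivatives. -/
theorem incl_injective : Function.Injective (incl κ W) := by
  rw [injective_iff_map_eq_zero]
  intro u hu
  have hs : u.1 .state = 0 := hu
  obtain ⟨hpot, hgrad⟩ := u.2
  refine Subtype.ext (PiLp.ext fun i => ?_)
  change u.1 i = 0
  cases i with
  | state => exact hs
  | pot =>
    refine Lp.ext ?_
    filter_upwards [hpot, Lp.coeFn_zero ℂ 2 (volume : Measure (Cfg N d))] with x h1 h2
    rw [h1, hs, h2]
    simp
  | grad p =>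
    refine eq_zero_of_forall_integral_eq_zero fun φ hφ hc => ?_
    have h := hgrad p φ hφ hc
    rw [hs, smul_zero] at h
    have h0 : ∫ x, ((fderiv ℝ φ x (EuclideanSpace.single p 1) : ℝ) : ℂ) * (0 : L2 N d) x = 0 := by
      refine integral_eq_zero_of_ae ?_
      filter_upwards [Lp.coeFn_zero ℂ 2 (volume : Measure (Cfg N d))] with x hx
      rw [hx]
      simp
    rw [h0] at h
    exact neg_eq_zero.mp h.symm

/-- Test functions belong to the form domain. -/
theorem exists_formDomain_of_test (hW : ∀ x, 0 ≤ W x) (hWl : LocallyIntegrable W volume)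
    {φ : Cfg N d → ℝ} (hφ : ContDiff ℝ ((⊤ : ℕ∞) : WithTop ℕ∞) φ) (hc : HasCompactSupport φ) :
    ∃ u : FormDomain κ W, incl κ W u =ᵐ[volume] fun x => (φ x : ℂ) := by
  have hcont : ∀ ψ : Cfg N d → ℝ, Continuous ψ → HasCompactSupport ψ →
      MemLp (fun x => (ψ x : ℂ)) 2 (volume : Measure (Cfg N d)) := fun ψ h1 h2 =>
    (Complex.continuous_ofReal.comp h1).memLp_of_hasCompactSupport
      (h2.comp_left (g := fun t : ℝ => (t : ℂ)) rfl)
  have hs := hcont φ hφ.continuous hc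
  have hder : ∀ v, Continuous fun x => fderiv ℝ φ x v := fun v =>
    (hφ.continuous_fderiv (by simp)).clm_apply continuous_const
  have hg : ∀ p : Fin N × Fin d, MemLp
      (fun x => ((fderiv ℝ φ x (EuclideanSpace.single p 1) : ℝ) : ℂ)) 2
      (volume : Measure (Cfg N d)) :=
    fun p => hcont _ (hder _) (hc.fderiv_apply ℝ _)
  have hp : MemLp (fun x => (√(W x) : ℂ) * (φ x : ℂ)) 2 (volume : Measure (Cfg N d)) := by
    have hm : AEStronglyMeasurable (fun x => (√(W x) : ℂ) * (φ x : ℂ))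
        (volume : Measure (Cfg N d)) := by
      refine AEStronglyMeasurable.mul ?_ hs.aestronglyMeasurable
      exact (Complex.continuous_ofReal.comp Real.continuous_sqrt).comp_aestronglyMeasurable
        hWl.aestronglyMeasurable
    rw [memLp_two_iff_integrable_sq_norm hm]
    -- Local integrability of `𝒲` is exactly what makes `√𝒲 φ` square integrable.
    have h1 : Integrable (fun x => (φ x ^ 2) • W x) volume :=
      hWl.integrable_smul_left_of_hasCompactSupport (hφ.continuous.pow 2)
        (hc.comp_left (g := fun t : ℝ => t ^ 2) (by simp))
    refine h1.congr (Eventually.of_forall fun x => ?_)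
    simp only [norm_mul, Complex.norm_real, Real.norm_eq_abs, mul_pow, sq_abs,
      Real.sq_sqrt (hW x), smul_eq_mul, mul_comm]
  set u : PiLp 2 fun _ : Comp N d => L2 N d := WithLp.toLp 2 fun i =>
    match i with
    | .state => hs.toLp _
    | .pot => hp.toLp _
    | .grad p => ((√(κ p.1) : ℝ) : ℂ) • (hg p).toLp _ with hu
  have hmem : u ∈ formSubmodule κ W := by
    refine ⟨?_, fun p ψ hψ hψc => ?_⟩
    · change ∀ᵐ x, hp.toLp _ x = (√(W x) : ℂ) * hs.toLp _ x
      filter_upwards [hs.coeFn_toLp, hp.coeFn_toLp] with x h1 h2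
      rw [h1, h2]
    · change ∫ x, ((fderiv ℝ ψ x (EuclideanSpace.single p 1) : ℝ) : ℂ) *
          (((√(κ p.1) : ℝ) : ℂ) • hs.toLp _ : L2 N d) x =
        -∫ x, (ψ x : ℂ) * (((√(κ p.1) : ℝ) : ℂ) • (hg p).toLp _ : L2 N d) x
      set v : Cfg N d := EuclideanSpace.single p 1
      have hψd : Continuous fun x => fderiv ℝ ψ x v :=
        (hψ.continuous_fderiv (by simp)).clm_apply continuous_const
      have hparts : ∫ x, φ x * fderiv ℝ ψ x v = -∫ x, fderiv ℝ φ x v * ψ x := by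
        refine integral_mul_fderiv_eq_neg_fderiv_mul_of_integrable ?_ ?_ ?_
          (fun x _ => (hφ.differentiable (by simp)).differentiableAt)
          (fun x _ => (hψ.differentiable (by simp)).differentiableAt)
        · exact ((hder v).mul hψ.continuous).integrable_of_hasCompactSupport hψc.mul_left
        · exact (hφ.continuous.mul hψd).integrable_of_hasCompactSupport hc.mul_right
        · exact (hφ.continuous.mul hψ.continuous).integrable_of_hasCompactSupport hc.mul_right
      have h1 : ∫ x, ((fderiv ℝ ψ x v : ℝ) : ℂ) * (((√(κ p.1) : ℝ) : ℂ) • hs.toLp _ : L2 N d) x =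
          ((√(κ p.1) : ℝ) : ℂ) * ((∫ x, φ x * fderiv ℝ ψ x v : ℝ) : ℂ) := by
        rw [← integral_complex_ofReal, ← integral_const_mul]
        refine integral_congr_ae ?_
        filter_upwards [hs.coeFn_toLp, Lp.coeFn_smul ((√(κ p.1) : ℝ) : ℂ) (hs.toLp _)] with x h1 h2
        rw [h2, Pi.smul_apply, h1, smul_eq_mul]
        push_cast
        ring
      have h2 : ∫ x, (ψ x : ℂ) * (((√(κ p.1) : ℝ) : ℂ) • (hg p).toLp _ : L2 N d) x =
          ((√(κ p.1) : ℝ) : ℂ) * ((∫ x, fderiv ℝ φ x v * ψ x : ℝ) : ℂ) := by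
        rw [← integral_complex_ofReal, ← integral_const_mul]
        refine integral_congr_ae ?_
        filter_upwards [(hg p).coeFn_toLp,
          Lp.coeFn_smul ((√(κ p.1) : ℝ) : ℂ) ((hg p).toLp _)] with x h1 h2
        rw [h2, Pi.smul_apply, h1, smul_eq_mul]
        push_cast
        ring
      rw [h1, h2, hparts]
      push_cast
      ring
  exact ⟨⟨u, hmem⟩, hs.coeFn_toLp⟩

theorem denseRange_incl (hW : ∀ x, 0 ≤ W x) (hWl : LocallyIntegrable W volume) :
    DenseRange (incl κ W) := by
  have h : (LinearMap.range (incl κ W).toLinearMap)ᗮ = ⊥ := by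
    rw [Submodule.eq_bot_iff]
    intro f hf
    refine eq_zero_of_forall_integral_eq_zero fun φ hφ hc => ?_
    obtain ⟨u, hu⟩ := exists_formDomain_of_test (κ := κ) hW hWl hφ hc
    have h1 := (Submodule.mem_orthogonal _ _).mp hf _ ⟨u, rfl⟩
    rw [L2.inner_def] at h1
    rw [← h1]
    refine integral_congr_ae ?_
    filter_upwards [hu] with x hx
    rw [RCLike.inner_apply]
    change _ = f x * starRingEnd ℂ (incl κ W u x)
    rw [hx, Complex.conj_ofReal, mul_comm]
  exact Submodule.dense_iff_topologicalClosure_eq_top.mpr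
    (Submodule.topologicalClosure_eq_top_iff.mpr h)

theorem sum_comp {M : Type*} [AddCommMonoid M] (f : Comp N d → M) :
    ∑ i, f i = f .state + (f .pot + ∑ p, f (.grad p)) := by
  let e : Option (Option (Fin N × Fin d)) ≃ Comp N d :=
    { toFun := fun o => match o with
        | none => .state
        | some none => .pot
        | some (some p) => .grad p
      invFun := fun c => match c with
        | .state => none
        | .pot => some none
        | .grad p => some (some p)
      left_inv := by rintro (_ | _ | _) <;> rfl
      right_inv := by rintro (_ | _ | _) <;> rfl }
  rw [← Equiv.sum_comp e, Fintype.sum_option, Fintype.sum_option]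
  rfl

theorem inner_formDomain (u v : FormDomain κ W) :
    inner ℂ u v = inner ℂ (u.1 .state) (v.1 .state) + freeForm u v := by
  rw [Submodule.coe_inner, PiLp.inner_apply, sum_comp, freeForm]

theorem norm_sq_formDomain (u : FormDomain κ W) :
    ‖u‖ ^ 2 = ‖u.1 .state‖ ^ 2 + (‖u.1 .pot‖ ^ 2 + ∑ p, ‖u.1 (.grad p)‖ ^ 2) := by
  rw [Submodule.coe_norm, PiLp.norm_sq_eq_of_L2, sum_comp]

/-- The component of an element of the form domain. -/
def component (κ : Fin N → ℝ) (W : Cfg N d → ℝ) (i : Comp N d) : FormDomain κ W →L[ℂ] L2 N d :=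
  (PiLp.proj 2 (fun _ : Comp N d => L2 N d) i) ∘L (formSubmodule κ W).subtypeL

@[simp]
theorem component_apply (i : Comp N d) (u : FormDomain κ W) : component κ W i u = u.1 i := rfl

/-- The minimizer equivalence for perturbations of `T` of first order with bounded coefficients. -/
theorem minimizerEquivalence_of_perturbation {X : Type*} [MeasurableSpace X]
    [MeasurableSpace.CountablyGenerated X] [MeasurableSingletonClass X]
    (hW : ∀ x, 0 ≤ W x) (hWl : LocallyIntegrable W volume)
    {a : X → FormDomain κ W → FormDomain κ W → ℂ}
    (ha : ∀ z, ∃ (B : Fin N × Fin d → BOp (L2 N d)) (D : BOp (L2 N d)), IsSelfAdjoint D ∧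
      ∀ u v, a z u v = inner ℂ u v
        + ∑ p, (inner ℂ (u.1 (.grad p)) (B p (v.1 .state))
            + inner ℂ (B p (u.1 .state)) (v.1 (.grad p)))
        + inner ℂ (u.1 .state) (D (v.1 .state))) :
    MinimizerEquivalence (incl κ W) a := by
  refine minimizerEquivalence_of_coercive incl_injective (denseRange_incl hW hWl)
    (fun z => ?_) (fun z => ?_)
  · obtain ⟨B, D, -, h⟩ := ha z
    refine ⟨1 + ∑ p, (ContinuousLinearMap.adjoint (component κ W (.grad p)) ∘L B p ∘L
        component κ W .state + ContinuousLinearMap.adjoint (component κ W .state) ∘L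
          ContinuousLinearMap.adjoint (B p) ∘L component κ W (.grad p))
      + ContinuousLinearMap.adjoint (component κ W .state) ∘L D ∘L component κ W .state,
      fun u v => ?_⟩
    rw [h]
    simp only [add_apply, sum_apply, one_apply_eq_self, inner_add_right,
      inner_sum, ContinuousLinearMap.comp_apply, ContinuousLinearMap.adjoint_inner_right,
      component_apply]
  · obtain ⟨B, D, hD, h⟩ := ha z
    -- Half of the gradient terms absorbs the cross terms by Young's inequality, at the price of `2
    -- ‖B p‖²` for each `p`; `‖D‖` bounds the term of order zero.
    refine ⟨1 / 2, by norm_num, ∑ p, 2 * ‖B p‖ ^ 2 + ‖D‖, fun u => ?_⟩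
    set s := u.1 .state with hs
    have hJ : incl κ W u = s := rfl
    have hDre : inner ℂ s (D s) = ((inner ℂ s (D s)).re : ℂ) := by
      have h1 : ContinuousLinearMap.adjoint D = D := hD
      have h2 : starRingEnd ℂ (inner ℂ s (D s)) = inner ℂ s (D s) := by
        rw [inner_conj_symm]
        conv_lhs => rw [← h1]
        exact ContinuousLinearMap.adjoint_inner_left _ _ _
      exact (Complex.conj_eq_iff_re.mp h2).symm
    have hcross : ∀ p, inner ℂ (u.1 (.grad p)) (B p s) + inner ℂ (B p s) (u.1 (.grad p)) =
        ((2 * (inner ℂ (u.1 (.grad p)) (B p s)).re : ℝ) : ℂ) := by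
      intro p
      rw [← inner_conj_symm (B p s), Complex.add_conj]
    have huu : inner ℂ u u = ((‖u‖ ^ 2 : ℝ) : ℂ) :=
      (inner_self_eq_norm_sq_to_K (𝕜 := ℂ) u).trans (by simp)
    rw [h, huu, Finset.sum_congr rfl fun p _ => hcross p, hDre, hJ, ← Complex.ofReal_sum,
      ← Complex.ofReal_add, ← Complex.ofReal_add, Complex.real_le_real]
    have h1 : ∀ p, -(1 / 2 * ‖u.1 (.grad p)‖ ^ 2 + 2 * ‖B p‖ ^ 2 * ‖s‖ ^ 2) ≤
        2 * (inner ℂ (u.1 (.grad p)) (B p s)).re := by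
      intro p
      have h2 := (Complex.abs_re_le_norm _).trans (norm_inner_le_norm (𝕜 := ℂ) (u.1 (.grad p)) (B p s))
      have h3 := (B p).le_opNorm s
      have h4 := mul_le_mul_of_nonneg_left h3 (norm_nonneg (u.1 (.grad p)))
      have h5 := neg_le_of_abs_le (h2.trans h4)
      nlinarith [sq_nonneg (‖u.1 (.grad p)‖ - 2 * (‖B p‖ * ‖s‖))]
    have h2 : -(‖D‖ * ‖s‖ ^ 2) ≤ (inner ℂ s (D s)).re := by
      have h3 := (Complex.abs_re_le_norm _).trans (norm_inner_le_norm (𝕜 := ℂ) s (D s))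
      have h4 := mul_le_mul_of_nonneg_left (D.le_opNorm s) (norm_nonneg s)
      have h5 := neg_le_of_abs_le (h3.trans h4)
      nlinarith
    have h3 := Finset.sum_le_sum fun p (_ : p ∈ Finset.univ) => h1 p
    rw [Finset.sum_neg_distrib, Finset.sum_add_distrib, ← Finset.mul_sum, ← Finset.sum_mul] at h3
    have h4 := norm_sq_formDomain u
    have h5 : ∑ p, ‖u.1 (.grad p)‖ ^ 2 ≤ ‖u‖ ^ 2 := by
      nlinarith [sq_nonneg ‖u.1 .state‖, sq_nonneg ‖u.1 .pot‖]
    linarith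

end FormDomain

/-! ### Multiplication by bounded functions of one particle. -/

section Multiplication

variable {N d : ℕ}

/-- Multiplication by a bounded real function. -/
theorem exists_mulOp {b : Cfg N d → ℝ} (hm : AEStronglyMeasurable b volume) {C : ℝ}
    (hb : ∀ᵐ x, ‖b x‖ ≤ C) :
    ∃ M : BOp (L2 N d), IsSelfAdjoint M ∧ (∀ f, M f =ᵐ[volume] fun x => (b x : ℂ) * f x) ∧
      ∀ f g, mulForm (fun x => (b x : ℂ)) f g = inner ℂ f (M g) := by
  have hmem : MemLp (fun x => (b x : ℂ)) ⊤ (volume : Measure (Cfg N d)) :=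
    memLp_top_of_bound (Complex.continuous_ofReal.comp_aestronglyMeasurable hm) C
      (by simpa using hb)
  set M : BOp (L2 N d) :=
    (ContinuousLinearMap.mul ℂ ℂ).holderL volume ⊤ 2 2 (hmem.toLp _) with hM
  have hMf : ∀ f : L2 N d, M f =ᵐ[volume] fun x => (b x : ℂ) * f x := by
    intro f
    filter_upwards [(ContinuousLinearMap.mul ℂ ℂ).coeFn_holder (r := 2) (hmem.toLp _) f,
      hmem.coeFn_toLp] with x h1 h2
    change ((ContinuousLinearMap.mul ℂ ℂ).holder 2 (hmem.toLp _) f) x = _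
    rw [h1, h2]
    rfl
  have hform : ∀ f g, mulForm (fun x => (b x : ℂ)) f g = inner ℂ f (M g) := by
    intro f g
    rw [mulForm, L2.inner_def]
    refine integral_congr_ae ?_
    filter_upwards [hMf g] with x hx
    rw [RCLike.inner_apply, hx]
    ring
  refine ⟨M, ?_, hMf, hform⟩
  rw [ContinuousLinearMap.isSelfAdjoint_iff_isSymmetric]
  intro f g
  change inner ℂ (M f) g = inner ℂ f (M g)
  rw [L2.inner_def, L2.inner_def]
  refine integral_congr_ae ?_
  filter_upwards [hMf f, hMf g] with x h1 h2
  rw [RCLike.inner_apply, RCLike.inner_apply, h1, h2, map_mul, Complex.conj_ofReal]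
  ring

/-- The map `x ↦ x_j` as a linear map. -/
def posLinear (j : Fin N) : Cfg N d →ₗ[ℝ] EuclideanSpace ℝ (Fin d) where
  toFun x := pos x j
  map_add' _ _ := rfl
  map_smul' _ _ := rfl

theorem posLinear_surjective (j : Fin N) :
    Function.Surjective (posLinear j : Cfg N d →ₗ[ℝ] EuclideanSpace ℝ (Fin d)) := by
  intro y
  refine ⟨WithLp.toLp 2 fun p => y p.2, ?_⟩
  ext i
  rfl

/-- A surjective linear map sends Lebesgue measure to a multiple, possibly infinite, of Lebesgue
measure. Hence almost everywhere bounds on `ℝᵈ` pull back. -/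
theorem quasiMeasurePreserving_pos (j : Fin N) :
    Measure.QuasiMeasurePreserving (fun x : Cfg N d => pos x j) volume volume := by
  refine ⟨(LinearMap.continuous_of_finiteDimensional (posLinear j)).measurable, ?_⟩
  obtain ⟨c, -, hc⟩ := LinearMap.exists_map_addHaar_eq_smul_addHaar (posLinear (d := d) j)
    volume volume (posLinear_surjective j)
  change Measure.map (posLinear j) volume ≪ volume
  rw [hc]
  exact Measure.smul_absolutelyContinuous

/-- Multiplication by a bounded real function of one particle. -/
theorem exists_mulOp_pos {b : EuclideanSpace ℝ (Fin d) → ℝ} (hm : AEStronglyMeasurable b volume)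
    {C : ℝ} (hb : ∀ᵐ y, ‖b y‖ ≤ C) (j : Fin N) :
    ∃ M : BOp (L2 N d), IsSelfAdjoint M ∧
      (∀ f, M f =ᵐ[volume] fun x => (b (pos x j) : ℂ) * f x) ∧
      ∀ f g, mulForm (fun x => (b (pos x j) : ℂ)) f g = inner ℂ f (M g) :=
  exists_mulOp (hm.comp_quasiMeasurePreserving (quasiMeasurePreserving_pos j))
    ((quasiMeasurePreserving_pos j).ae hb)

end Multiplication

/-! ### The field space: separability, and boundedness of the classical field. -/

section FieldSpace

variable {𝔥 : Type*} [NormedAddCommGroup 𝔥] [InnerProductSpace ℂ 𝔥] [CompleteSpace 𝔥]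

namespace Dispersion

variable (ω : Dispersion 𝔥)

theorem norm_sq_smoothVec_le (y : ω.SmoothVec) :
    ‖y‖ ^ 2 ≤ ‖(ω.toDomain y : 𝔥)‖ * ‖ω.op (ω.toDomain y)‖ := by
  have h1 : ‖y‖ ^ 2 = (inner ℂ (ω.toDomain y : 𝔥) (ω.op (ω.toDomain y))).re :=
    norm_sq_eq_re_inner (𝕜 := ℂ) y
  rw [h1]
  exact (Complex.re_le_norm _).trans (norm_inner_le_norm _ _)

/-- The form norm is dominated by the graph norm of `ω`, and the graph is a subset of the separable
metric space `𝔥 × 𝔥`. This makes the Borel sets of the field space countably generated, as the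
construction of densities requires. -/
instance [TopologicalSpace.SeparableSpace 𝔥] : TopologicalSpace.SeparableSpace ω.SmoothVec := by
  have : SecondCountableTopology 𝔥 := UniformSpace.secondCountable_of_separable 𝔥
  set Φ : ω.SmoothVec → 𝔥 × 𝔥 := fun y => (ω.toDomain y, ω.op (ω.toDomain y)) with hΦ
  -- `ψ` inverts the graph map; it is onto since a vector is recovered from its first component.
  choose ψ hψ using fun p : Set.range Φ => p.2
  have hsurj : Function.Surjective ψ := by
    intro y
    refine ⟨⟨Φ y, y, rfl⟩, ?_⟩
    have h1 : (ω.toDomain (ψ ⟨Φ y, y, rfl⟩) : 𝔥) = ω.toDomain y :=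
      congrArg Prod.fst (hψ ⟨Φ y, y, rfl⟩)
    exact Subtype.ext h1
  have hlip : LipschitzWith 1 ψ := by
    refine LipschitzWith.of_dist_le_mul fun p q => ?_
    rw [NNReal.coe_one, one_mul, dist_eq_norm]
    have h1 := ω.norm_sq_smoothVec_le (ψ p - ψ q)
    have h2 : ‖(ω.toDomain (ψ p - ψ q) : 𝔥)‖ ≤ dist p q := by
      have : (ω.toDomain (ψ p - ψ q) : 𝔥) = (p : 𝔥 × 𝔥).1 - (q : 𝔥 × 𝔥).1 := by
        rw [← hψ p, ← hψ q, map_sub]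
        rfl
      rw [this, ← dist_eq_norm]
      exact le_max_left _ _
    have h3 : ‖ω.op (ω.toDomain (ψ p - ψ q))‖ ≤ dist p q := by
      have : ω.op (ω.toDomain (ψ p - ψ q)) = (p : 𝔥 × 𝔥).2 - (q : 𝔥 × 𝔥).2 := by
        rw [← hψ p, ← hψ q, map_sub, LinearPMap.map_sub]
      rw [this, ← dist_eq_norm]
      exact le_max_right _ _
    refine abs_le_of_sq_le_sq' (h1.trans ?_) dist_nonneg |>.2
    rw [sq]
    exact mul_le_mul h2 h3 (norm_nonneg _) dist_nonneg
  exact hsurj.denseRange.separableSpace hlip.continuous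

variable {ω}

theorem uniformContinuous_inner {v : 𝔥} {C : ℝ} (hv : ω.InvSqrtBound v C) :
    UniformContinuous fun y : ω.SmoothVec => inner ℂ v (ω.toDomain y : 𝔥) := by
  refine (LipschitzWith.of_dist_le' (K := C) fun x y => ?_).uniformContinuous
  rw [dist_eq_norm, dist_eq_norm, ← inner_sub_right]
  have := hv (x - y)
  rwa [map_sub] at this

theorem continuous_pairing (v : 𝔥) : Continuous (ω.pairing v) :=
  UniformSpace.Completion.continuous_extension

theorem pairing_coe {v : 𝔥} {C : ℝ} (hv : ω.InvSqrtBound v C) (y : ω.SmoothVec) :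
    ω.pairing v (y : ω.FieldSpace) = inner ℂ v (ω.toDomain y : 𝔥) :=
  UniformSpace.Completion.extension_coe (uniformContinuous_inner hv) y

theorem norm_pairing_le {v : 𝔥} {C : ℝ} (hv : ω.InvSqrtBound v C) (z : ω.FieldSpace) :
    ‖ω.pairing v z‖ ≤ C * ‖z‖ := by
  induction z using UniformSpace.Completion.induction_on with
  | hp => exact isClosed_le (continuous_pairing v).norm (continuous_const.mul continuous_norm)
  | ih y =>
    rw [pairing_coe hv, UniformSpace.Completion.norm_coe]
    exact hv y

/-- Approximate `z` by a sequence of smooth vectors, for which the pairing is an ordinary inner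
product with `λ(x)`. -/
theorem aestronglyMeasurable_classicalField {d : ℕ} {lam : EuclideanSpace ℝ (Fin d) → 𝔥}
    (hlam : ω.IsFormFactor lam) (z : ω.FieldSpace) :
    AEStronglyMeasurable (ω.classicalField lam z) volume := by
  obtain ⟨hmem, C, hC⟩ := hlam
  obtain ⟨x, hx, hlim⟩ := mem_closure_iff_seq_limit.mp
    (UniformSpace.Completion.denseRange_coe (α := ω.SmoothVec) z)
  choose y hy using hx
  have h1 : AEStronglyMeasurable (fun k => ω.pairing (lam k) z) volume := by
    refine aestronglyMeasurable_of_tendsto_ae atTop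
      (f := fun n k => inner ℂ (lam k) (ω.toDomain (y n) : 𝔥))
      (fun n => hmem.aestronglyMeasurable.inner aestronglyMeasurable_const) ?_
    filter_upwards [hC] with k hk
    refine (((continuous_pairing (lam k)).tendsto z).comp hlim).congr fun n => ?_
    rw [Function.comp_apply, ← hy, pairing_coe hk]
  exact (Complex.continuous_re.comp_aestronglyMeasurable h1).const_mul 2

theorem exists_bound_classicalField {d : ℕ} {lam : EuclideanSpace ℝ (Fin d) → 𝔥}
    (hlam : ω.IsFormFactor lam) (z : ω.FieldSpace) :
    ∃ C : ℝ, ∀ᵐ x, ‖ω.classicalField lam z x‖ ≤ C := by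
  obtain ⟨-, C, hC⟩ := hlam
  refine ⟨2 * (C * ‖z‖), ?_⟩
  filter_upwards [hC] with x hx
  rw [classicalField, norm_mul, Real.norm_ofNat]
  exact mul_le_mul_of_nonneg_left ((Complex.abs_re_le_norm _).trans (norm_pairing_le hx z))
    zero_le_two

end Dispersion

end FieldSpace

/-! ### Measurability and bounds for the polaron fields. -/

section Polaron

variable {d : ℕ}

theorem measurable_polaronLow (r : ℝ) :
    Measurable (polaronLow r : EuclideanSpace ℝ (Fin d) → ℝ) := by
  refine Measurable.ite (measurableSet_le measurable_norm measurable_const) ?_ measurable_const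
  exact measurable_norm.pow_const _

theorem measurable_polaronHigh (r : ℝ) (i : Fin d) : Measurable (polaronHigh r i) := by
  refine Measurable.ite (measurableSet_lt measurable_const measurable_norm) ?_ measurable_const
  have : Measurable fun k : EuclideanSpace ℝ (Fin d) => k i := by fun_prop
  exact (measurable_norm.pow_const _).mul (this.div measurable_norm)

theorem stronglyMeasurable_polaronPairing {χ : EuclideanSpace ℝ (Fin d) → ℝ} (hχ : Measurable χ)
    (z : PolaronSpace d) : StronglyMeasurable (polaronPairing χ z) := by
  have hz : Measurable z := (Lp.stronglyMeasurable z).measurable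
  have h : StronglyMeasurable fun p : EuclideanSpace ℝ (Fin d) × EuclideanSpace ℝ (Fin d) =>
      starRingEnd ℂ (z p.2) * Complex.exp (-(Complex.I * ((inner ℝ p.2 p.1 : ℝ) : ℂ))) *
        (χ p.2 : ℂ) := by
    refine Measurable.stronglyMeasurable ?_
    have h1 : Measurable fun p : EuclideanSpace ℝ (Fin d) × EuclideanSpace ℝ (Fin d) =>
        starRingEnd ℂ (z p.2) :=
      Complex.continuous_conj.measurable.comp (hz.comp measurable_snd)
    have h2 : Measurable fun p : EuclideanSpace ℝ (Fin d) × EuclideanSpace ℝ (Fin d) =>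
        Complex.exp (-(Complex.I * ((inner ℝ p.2 p.1 : ℝ) : ℂ))) := by
      refine Continuous.measurable ?_
      fun_prop
    exact (h1.mul h2).mul (Complex.measurable_ofReal.comp (hχ.comp measurable_snd))
  exact h.integral_prod_right

/-- The phase has modulus one, so the bound is uniform in `x`. Should the product not be integrable,
both integrals have the default value zero. -/
theorem norm_polaronPairing_le (χ : EuclideanSpace ℝ (Fin d) → ℝ) (z : PolaronSpace d)
    (x : EuclideanSpace ℝ (Fin d)) : ‖polaronPairing χ z x‖ ≤ ∫ k, ‖z k‖ * ‖χ k‖ := by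
  refine (norm_integral_le_integral_norm _).trans (le_of_eq ?_)
  refine integral_congr_ae (Eventually.of_forall fun k => ?_)
  simp only
  rw [norm_mul, norm_mul, RCLike.norm_conj, Complex.norm_real, Complex.norm_exp]
  simp

end Polaron

/-! ### The three models as first-order perturbations of `T`. -/

section Models

variable {N d : ℕ} {κ : Fin N → ℝ}
  {𝔥 : Type*} [NormedAddCommGroup 𝔥] [InnerProductSpace ℂ 𝔥] [CompleteSpace 𝔥]

theorem isSelfAdjoint_ofReal_smul {E : Type*} [NormedAddCommGroup E] [InnerProductSpace ℂ E]
    [CompleteSpace E] (c : ℝ) {M : BOp E} (hM : IsSelfAdjoint M) :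
    IsSelfAdjoint ((c : ℂ) • M) :=
  IsSelfAdjoint.smul (Complex.conj_ofReal c) hM

theorem isSelfAdjoint_finset_sum {ι E : Type*} [NormedAddCommGroup E] [InnerProductSpace ℂ E]
    [CompleteSpace E] (s : Finset ι) {M : ι → BOp E} (hM : ∀ i, IsSelfAdjoint (M i)) :
    IsSelfAdjoint (∑ i ∈ s, M i) := by
  rw [isSelfAdjoint_iff, star_sum]
  exact Finset.sum_congr rfl fun i _ => hM i

variable [TopologicalSpace.SeparableSpace 𝔥]

theorem minimizerEquivalence_nelson {W : Cfg N d → ℝ} (hW : ∀ x, 0 ≤ W x)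
    (hWl : LocallyIntegrable W volume) (ω : Dispersion 𝔥) {lam : EuclideanSpace ℝ (Fin d) → 𝔥}
    (hlam : ω.IsFormFactor lam) :
    MinimizerEquivalence (incl κ W) (nelsonForm ω lam) := by
  refine minimizerEquivalence_of_perturbation hW hWl fun z => ?_
  obtain ⟨C, hC⟩ := Dispersion.exists_bound_classicalField hlam z
  choose M hMs _ hM using
    exists_mulOp_pos (N := N) (Dispersion.aestronglyMeasurable_classicalField hlam z) hC
  -- The `-1` compensates for the `+1` in `T`, whose form is the inner product of the form domain.
  refine ⟨0, ∑ j, M j + ((‖z‖ ^ 2 - 1 : ℝ) : ℂ) • 1,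
    (isSelfAdjoint_finset_sum _ hMs).add
      (isSelfAdjoint_ofReal_smul _ (IsSelfAdjoint.one (BOp (L2 N d)))), fun u v => ?_⟩
  rw [nelsonForm, inner_formDomain]
  simp only [hM, Pi.zero_apply, zero_apply, inner_zero_left, inner_zero_right, add_zero,
    Finset.sum_const_zero, add_apply, sum_apply, smul_apply, one_apply_eq_self, inner_add_right,
    inner_sum, inner_smul_right]
  push_cast
  ring

theorem minimizerEquivalence_polaron {W : Cfg N d → ℝ} (hW : ∀ x, 0 ≤ W x)
    (hWl : LocallyIntegrable W volume) (α r : ℝ) :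
    MinimizerEquivalence (incl (fun _ => 1) W) (polaronForm α r) := by
  have : Fact ((2 : ℝ≥0∞) ≠ ∞) := ⟨ENNReal.ofNat_ne_top⟩
  -- Here the field space is `L²` itself, and its second countability makes the Borel sets countably
  -- generated.
  have : SecondCountableTopology (PolaronSpace d) := Lp.SecondCountableTopology
  refine minimizerEquivalence_of_perturbation hW hWl fun z => ?_
  have hlow : StronglyMeasurable (polaronLowField r z) :=
    (Complex.continuous_re.comp_stronglyMeasurable
      (stronglyMeasurable_polaronPairing (measurable_polaronLow r) z)).const_mul 2
  have hhigh : ∀ i, StronglyMeasurable (polaronHighField r z i) := fun i =>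
    (Complex.continuous_re.comp_stronglyMeasurable
      ((stronglyMeasurable_polaronPairing (measurable_polaronHigh r i) z).const_mul _)).const_mul 2
  choose L hLs _ hL using exists_mulOp_pos (N := N) hlow.aestronglyMeasurable
    (C := 2 * ∫ k, ‖z k‖ * ‖polaronLow r k‖) (Eventually.of_forall fun x => by
      rw [polaronLowField, norm_mul, Real.norm_ofNat]
      exact mul_le_mul_of_nonneg_left ((Complex.abs_re_le_norm _).trans
        (norm_polaronPairing_le _ z x)) zero_le_two)
  choose G hGs _ hG using fun i => exists_mulOp_pos (N := N) (hhigh i).aestronglyMeasurable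
    (C := 2 * ∫ k, ‖z k‖ * ‖polaronHigh r i k‖) (Eventually.of_forall fun x => by
      rw [polaronHighField, norm_mul, Real.norm_ofNat]
      refine mul_le_mul_of_nonneg_left ((Complex.abs_re_le_norm _).trans ?_) zero_le_two
      rw [norm_mul, Complex.norm_I, one_mul]
      exact norm_polaronPairing_le _ z x)
  -- The commutator form supplies the first-order coefficients with a minus sign; the low
  -- frequencies are of order zero.
  refine ⟨fun p => ((-√α : ℝ) : ℂ) • G p.2 p.1,
    ((√α : ℝ) : ℂ) • ∑ j, L j + ((‖z‖ ^ 2 - 1 : ℝ) : ℂ) • 1,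
    (isSelfAdjoint_ofReal_smul _ (isSelfAdjoint_finset_sum _ hLs)).add
      (isSelfAdjoint_ofReal_smul _ (IsSelfAdjoint.one (BOp (L2 N d)))), fun u v => ?_⟩
  have hsymm : ∀ i j (f g : L2 N d), inner ℂ (G i j f) g = inner ℂ f (G i j g) := fun i j =>
    (ContinuousLinearMap.isSelfAdjoint_iff_isSymmetric.mp (hGs i j))
  rw [polaronForm, inner_formDomain, Fintype.sum_prod_type]
  simp only [hL, hG, add_apply, sum_apply, smul_apply, one_apply_eq_self, inner_add_right,
    inner_sum, inner_smul_right, inner_smul_left, hsymm, Complex.conj_ofReal,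
    Finset.sum_sub_distrib, Finset.sum_add_distrib, ← Finset.mul_sum]
  push_cast
  ring

theorem minimizerEquivalence_pauliFierz {W : Cfg N 3 → ℝ} (hW : ∀ x, 0 ≤ W x)
    (hWl : LocallyIntegrable W volume) (ω : Dispersion 𝔥)
    {lam : Fin N → Fin 3 → EuclideanSpace ℝ (Fin 3) → 𝔥}
    (hlam : ∀ j ℓ, ω.IsFormFactor (lam j ℓ)) (e : ℝ) :
    MinimizerEquivalence (incl κ W) (pauliFierzForm ω lam e) := by
  refine minimizerEquivalence_of_perturbation hW hWl fun z => ?_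
  have hex : ∀ p : Fin N × Fin 3, ∃ M : BOp (L2 N 3), IsSelfAdjoint M ∧ ∀ f, M f =ᵐ[volume]
      fun x => ((√(κ p.1) * e * ω.classicalField (lam p.1 p.2) z (pos x p.1) : ℝ) : ℂ) * f x := by
    intro p
    obtain ⟨C, hC⟩ := Dispersion.exists_bound_classicalField (hlam p.1 p.2) z
    obtain ⟨M, h1, h2, -⟩ := exists_mulOp_pos (N := N)
      (b := fun y => √(κ p.1) * e * ω.classicalField (lam p.1 p.2) z y)
      (C := ‖√(κ p.1) * e‖ * C)
      ((Dispersion.aestronglyMeasurable_classicalField (hlam p.1 p.2) z).const_mul _)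
      (hC.mono fun y hy => by
        rw [norm_mul]
        exact mul_le_mul_of_nonneg_left hy (norm_nonneg _)) p.1
    exact ⟨M, h1, h2⟩
  choose M hMs hM using hex
  have hsymm : ∀ p (f g : L2 N 3), inner ℂ (M p f) g = inner ℂ f (M p g) := fun p =>
    (ContinuousLinearMap.isSelfAdjoint_iff_isSymmetric.mp (hMs p))
  have hcov : ∀ (u : FormDomain κ W) p, covDeriv ω lam e z u p =ᵐ[volume]
      ((-Complex.I) • u.1 (.grad p) + M p (u.1 .state) : L2 N 3) := by
    intro u p
    filter_upwards [hM p (u.1 .state), Lp.coeFn_add ((-Complex.I) • u.1 (.grad p)) (M p (u.1 .state)),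
      Lp.coeFn_smul (-Complex.I) (u.1 (.grad p))] with x h1 h2 h3
    rw [h2, Pi.add_apply, h3, Pi.smul_apply, h1, smul_eq_mul, covDeriv]
  have hint : ∀ (u v : FormDomain κ W) p,
      ∫ x, starRingEnd ℂ (covDeriv ω lam e z u p x) * covDeriv ω lam e z v p x =
        inner ℂ ((-Complex.I) • u.1 (.grad p) + M p (u.1 .state))
          ((-Complex.I) • v.1 (.grad p) + M p (v.1 .state)) := by
    intro u v p
    rw [L2.inner_def]
    refine integral_congr_ae ?_
    filter_upwards [hcov u p, hcov v p] with x h1 h2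
    rw [RCLike.inner_apply, h1, h2, mul_comm]
  -- Expand the square of `-i∂ + M`: the cross terms give the coefficient `i M`, and the square of
  -- the vector potential is bounded of order zero.
  refine ⟨fun p => Complex.I • M p, ∑ p, M p * M p + ((‖z‖ ^ 2 - 1 : ℝ) : ℂ) • 1,
    (isSelfAdjoint_finset_sum _ fun p => ?_).add
      (isSelfAdjoint_ofReal_smul _ (IsSelfAdjoint.one (BOp (L2 N 3)))), fun u v => ?_⟩
  · rw [isSelfAdjoint_iff, star_mul, (hMs p).star_eq]
  · rw [pauliFierzForm, inner_formDomain, freeForm]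
    simp only [hint, add_apply, sum_apply, smul_apply, one_apply_eq_self, mul_apply_eq_comp,
      inner_add_right, inner_add_left, inner_sum, inner_smul_right, inner_smul_left, hsymm,
      map_neg, Complex.conj_I, Finset.sum_add_distrib, ← Finset.mul_sum]
    push_cast
    linear_combination
      (-∑ p, inner ℂ (u.1 (.grad p)) (v.1 (.grad p))) * Complex.I_mul_I

end Models

end QuasiClassical

end

theorem mainTheorem12 (N : ℕ) :
    -- Nelson model
    (∀ (d : ℕ) (_ : 1 ≤ d ∧ d ≤ 3)
      (W : QuasiClassical.Cfg N d → ℝ) (_ : ∀ x, 0 ≤ W x)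
      (_ : MeasureTheory.LocallyIntegrable W MeasureTheory.volume)
      (𝔥 : Type*) [NormedAddCommGroup 𝔥] [InnerProductSpace ℂ 𝔥] [CompleteSpace 𝔥]
      [TopologicalSpace.SeparableSpace 𝔥] (ω : QuasiClassical.Dispersion 𝔥)
      (lam : EuclideanSpace ℝ (Fin d) → 𝔥) (_ : ω.IsFormFactor lam),
      QuasiClassical.MinimizerEquivalence (QuasiClassical.incl (fun _ => 1) W)
        (QuasiClassical.nelsonForm ω lam)) ∧
    -- Fröhlich polaron
    (∀ (d : ℕ) (_ : 1 ≤ d ∧ d ≤ 3)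
      (W : QuasiClassical.Cfg N d → ℝ) (_ : ∀ x, 0 ≤ W x)
      (_ : MeasureTheory.LocallyIntegrable W MeasureTheory.volume)
      (α : ℝ) (_ : 0 < α) (r : ℝ) (_ : 0 < r),
      QuasiClassical.MinimizerEquivalence (QuasiClassical.incl (fun _ => 1) W)
        (QuasiClassical.polaronForm α r)) ∧
    -- Pauli-Fierz model
    (∀ (W : QuasiClassical.Cfg N 3 → ℝ) (_ : ∀ x, 0 ≤ W x)
      (_ : MeasureTheory.LocallyIntegrable W MeasureTheory.volume)
      (𝔥 : Type*) [NormedAddCommGroup 𝔥] [InnerProductSpace ℂ 𝔥] [CompleteSpace 𝔥]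
      [TopologicalSpace.SeparableSpace 𝔥] (ω : QuasiClassical.Dispersion 𝔥)
      (m : Fin N → ℝ) (_ : ∀ j, 0 < m j) (e : ℝ)
      (lam : Fin N → Fin 3 → EuclideanSpace ℝ (Fin 3) → 𝔥)
      (_ : ∀ j ℓ, ω.IsFormFactor (lam j ℓ)),
      QuasiClassical.MinimizerEquivalence
        (QuasiClassical.incl (QuasiClassical.massCoeff m) W)
        (QuasiClassical.pauliFierzForm ω lam e)) := by
  refine ⟨?_, ?_, ?_⟩
  · intro d _ W hW hWl 𝔥 _ _ _ _ ω lam hlam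
    exact QuasiClassical.minimizerEquivalence_nelson hW hWl ω hlam
  · intro d _ W hW hWl α _ r _
    exact QuasiClassical.minimizerEquivalence_polaron hW hWl α r
  · intro W hW hWl 𝔥 _ _ _ _ ω m _ e lam hlam
    exact QuasiClassical.minimizerEquivalence_pauliFierz hW hWl ω hlam e
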